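/- Let $a=c_0<c_1<\dots<c_{\ell+1}=b$ and $S=\{0,\dots,\ell\}$. For $i\in S$ let $I_i=\,]c_i,c_{i+1}[$, let $f_i:I_i\to[a,b]$ be continuous and strictly monotone, with $s_i=+1$ if $f_i$ is increasing and $s_i=-1$ if it is decreasing, and let $g_i\ge 0$ be a weight. For a word $i_0\cdots i_{n-1}$ define its cylinder recursively by $(i_0)=I_{i_0}$ and $(i_0i_1\cdots i_{n-1})=I_{i_0}\cap f_{i_0}^{-1}(i_1\cdots i_{n-1})$; let $Z_n$ be the set of non-empty cylinders of level $n$, and for $\alpha=(i_0\cdots i_{n-1})\in Z_n$ put $g^m_{|\alpha}=\prod_{k<m}g_{i_k}$ for $m\le n$. Put $$\rho_\infty=\limsup_{n\to\infty}\Big(\sup_{\alpha\in Z_n}g^n_{|\alpha}\Big)^{1/n},\qquad \rho_1=\limsup_{n\to\infty}\Big(\sum_{\alpha\in Z_n}g^n_{|\alpha}\Big)^{1/n},$$ and call $\log\rho_1$ the pressure of $(I_i,f_i,g_i)_{i\in S}$ (the pressure of any finite family of weighted branches is defined in the same way). For $J\subset\,]a,b[$ let $$L(J,t)=\tfrac12\sum_{n\ge0}t^n\sum_{\alpha=]u,v[\,\in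 Z_{n+1}}g^n_{|\alpha}\,\big(\chi_J(u)+\chi_J(v)\big),$$ and $\phi_t(x^-)=L(]a,x[,t)/L(]a,b[,t)$ for $a<x\le b$, $\phi_t(x^+)=L(]a,x],t)/L(]a,b[,t)$ for $a\le x<b$. Assume $\rho_1>\rho_\infty$. Then for $0\le t<1/\rho_1$ the series $L(]a,b[,t)$ converges to a positive number, and there is a non-decreasing continuous surjective map $\phi:[a,b]\to[0,1]$ with $$\phi(x)=\lim_{t\nearrow1/\rho_1}\phi_t(x^-)\ (a<x\le b),\qquad \phi(x)=\lim_{t\nearrow1/\rho_1}\phi_t(x^+)\ (a\le x<b),$$ and with the following properties. Let $\widetilde I_i=\mathrm{Int}\,\phi(I_i)$ and let $\widetilde S\subset S$ be the set of those $i$ for which $\widetilde I_i$ is non-empty. A. For every $i\in\widetilde S$ one has $g_i>0$, and there is an affine map $\widetilde f_i$ of slope $s_i\rho_1/g_i$, mapping $\widetilde I_i$ into $[0,1]$, such that $\widetilde f_i(\phi(x))=\phi(f_i(x))$ for all $x\in I_i$. B. The systems $(I_i,f_i,g_i)_{i\in S}$ and $(\widetilde I_i,\widetilde f_i,g_i)_{i\in\widetilde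 S}$ have the same pressure $\log\rho_1$. C. Suppose that the $f_i$ extend to a continuous map $f$ on $[a,b]$ and that $\phi\circ f_i$ is constant on $I_i$ for every $i$ with $g_i=0$ (no condition if all $g_i>0$). Then the $\widetilde f_i$, $i\in\widetilde S$, extend to a continuous map $\widetilde f:[0,1]\to[0,1]$, and $\widetilde f(\phi(x))=\phi(f(x))$ for every $x\in[a,b]$. -/

import Mathlib

open Set Filter Topology

/-- A finite family of partially defined maps of the line, each carrying a constant weight. -/
structure BranchSystem (ι : Type) where
  /-- the domain of the branch `i` -/
  dom : ι → Set ℝ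
  /-- the branch `i`; only its values on `dom i` matter -/
  map : ι → ℝ → ℝ
  /-- the weight of the branch `i` -/
  weight : ι → ℝ

namespace BranchSystem

variable {ι : Type}

/-- The cylinder `(i₀ i₁ ⋯ iₙ₋₁) = I_{i₀} ∩ f_{i₀}⁻¹ (i₁ ⋯ iₙ₋₁)`. The cylinder of the empty
word is the whole line, so that the cylinder of the one-letter word `(i)` is `I_i`. -/
def cylinder (F : BranchSystem ι) : (n : ℕ) → (Fin n → ι) → Set ℝ
  | 0, _ => univ
  | n + 1, w => F.dom (w 0) ∩ F.map (w 0) ⁻¹' F.cylinder n (Fin.tail w)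

/-- The product of the weights along a word: the constant value of `gⁿ` on its cylinder. -/
def wordWeight (F : BranchSystem ι) {n : ℕ} (w : Fin n → ι) : ℝ :=
  ∏ k, F.weight (w k)

variable [Fintype ι]

open Classical in
/-- `Zₙ`: the words of length `n` whose cylinder is non-empty. -/
noncomputable def Z (F : BranchSystem ι) (n : ℕ) : Finset (Fin n → ι) :=
  Finset.univ.filter fun w => (F.cylinder n w).Nonempty

/-- `‖gⁿ‖_∞`. -/
noncomputable def normInf (F : BranchSystem ι) (n : ℕ) : ℝ :=
  ⨆ w : {w // w ∈ F.Z n}, |F.wordWeight w.1|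

/-- `‖gⁿ‖₁`. -/
noncomputable def normOne (F : BranchSystem ι) (n : ℕ) : ℝ :=
  ∑ w ∈ F.Z n, |F.wordWeight w|

/-- `ρ_∞ = limsup ‖gⁿ‖_∞^{1/n}`. -/
noncomputable def rhoInf (F : BranchSystem ι) : ℝ :=
  limsup (fun n : ℕ => F.normInf n ^ (1 / (n : ℝ))) atTop

/-- `ρ₁ = limsup ‖gⁿ‖₁^{1/n}`. -/
noncomputable def rhoOne (F : BranchSystem ι) : ℝ :=
  limsup (fun n : ℕ => F.normOne n ^ (1 / (n : ℝ))) atTop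

/-- The pressure `log ρ₁`. -/
noncomputable def pressure (F : BranchSystem ι) : ℝ :=
  Real.log F.rhoOne

/-- The coefficient of `tⁿ` in the weighted lap function of `J`: half the sum of `gⁿ(x̂)` over
the boundary germs `x̂` of the cylinders of level `n + 1` whose base point lies in `J`. -/
noncomputable def lapCoeff (F : BranchSystem ι) (J : Set ℝ) (n : ℕ) : ℝ :=
  1 / 2 * ∑ w ∈ F.Z (n + 1), F.wordWeight (Fin.init w) *
    (J.indicator 1 (sInf (F.cylinder (n + 1) w)) + J.indicator 1 (sSup (F.cylinder (n + 1) w)))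

/-- The weighted lap function `L(J, t)`. -/
noncomputable def lap (F : BranchSystem ι) (J : Set ℝ) (t : ℝ) : ℝ :=
  ∑' n : ℕ, t ^ n * F.lapCoeff J n

end BranchSystem

/-- A weighted system on `[a, b]`: cutting points `a = c₀ < c₁ < ⋯ < c_{ℓ+1} = b`, continuous
strictly monotone maps `f_i : ]c_i, c_{i+1}[ → [a, b]` (which therefore extend continuously to
`[c_i, c_{i+1}]`), and real weights `g_i`. -/
structure WeightedSystem (a b : ℝ) (ℓ : ℕ) where
  cut : Fin (ℓ + 2) → ℝ
  cut_strictMono : StrictMono cut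
  cut_zero : cut 0 = a
  cut_last : cut (Fin.last (ℓ + 1)) = b
  /-- only the values of `f i` on `]c_i, c_{i+1}[` matter -/
  f : Fin (ℓ + 1) → ℝ → ℝ
  f_continuousOn : ∀ i, ContinuousOn (f i) (Ioo (cut i.castSucc) (cut i.succ))
  f_strict : ∀ i, StrictMonoOn (f i) (Ioo (cut i.castSucc) (cut i.succ)) ∨
    StrictAntiOn (f i) (Ioo (cut i.castSucc) (cut i.succ))
  f_mapsTo : ∀ i, MapsTo (f i) (Ioo (cut i.castSucc) (cut i.succ)) (Icc a b)
  g : Fin (ℓ + 1) → ℝ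

namespace WeightedSystem

variable {a b : ℝ} {ℓ : ℕ}

/-- `I_i = ]c_i, c_{i+1}[`. -/
def I (W : WeightedSystem a b ℓ) (i : Fin (ℓ + 1)) : Set ℝ :=
  Ioo (W.cut i.castSucc) (W.cut i.succ)

open Classical in
/-- The sign `s_i = ±1` of monotonicity of `f_i`. -/
noncomputable def s (W : WeightedSystem a b ℓ) (i : Fin (ℓ + 1)) : ℝ :=
  if StrictMonoOn (W.f i) (W.I i) then 1 else -1

/-- The family of branches `(I_i, f_i, g_i)`. -/
def branches (W : WeightedSystem a b ℓ) : BranchSystem (Fin (ℓ + 1)) where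
  dom := W.I
  map := W.f
  weight := W.g

/-- `φ_t(x⁻) = L(]a, x[, t) / L(]a, b[, t)`. -/
noncomputable def phiMinus (W : WeightedSystem a b ℓ) (t x : ℝ) : ℝ :=
  W.branches.lap (Ioo a x) t / W.branches.lap (Ioo a b) t

/-- `φ_t(x⁺) = L(]a, x], t) / L(]a, b[, t)`. -/
noncomputable def phiPlus (W : WeightedSystem a b ℓ) (t x : ℝ) : ℝ :=
  W.branches.lap (Ioc a x) t / W.branches.lap (Ioo a b) t

/-- `Ĩ_i = Int φ(I_i)`. -/
def image (W : WeightedSystem a b ℓ) (φ : ℝ → ℝ) (i : Fin (ℓ + 1)) : Set ℝ :=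
  interior (φ '' W.I i)

open Classical in
/-- `S̃`: the indices `i` for which `Int φ(I_i)` is non-empty. -/
noncomputable def survivors (W : WeightedSystem a b ℓ) (φ : ℝ → ℝ) : Finset (Fin (ℓ + 1)) :=
  Finset.univ.filter fun i => (W.image φ i).Nonempty

/-- The family `(Ĩ_i, f̃_i, g_i)` indexed by `i ∈ S̃`. -/
def model (W : WeightedSystem a b ℓ) (φ : ℝ → ℝ) (ft : Fin (ℓ + 1) → ℝ → ℝ) :
    BranchSystem {i // i ∈ W.survivors φ} where
  dom i := W.image φ i
  map i := ft i
  weight i := W.g i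

end WeightedSystem

/-! The engine is one relation. An end point of a cylinder that lies inside `I_i` is never a cutting
point, so `f_i` carries it to an end point of the tail cylinder. Hence for two one-sided germs `p`,
`q` in the same `I_i` the lap series of the points below them satisfy `L(p) - L(q) = s_i g_i t (L(f
p) - L(f q))` (`lapSeries_sub`).

Iterating along the itinerary of `p` gives `L(p) = ∑ j, K_j(p) B_j`, where the `B_j` do not depend
on `p` (`lapSeries_eq_sum`). Subtracting the expansions at `c_i⁻` from those at `c_i⁺` gives a
linear system for `B` whose matrix is the kneading matrix and whose right side consists of the lap
series of single cutting points (`kneadMatrix_mulVec`). All these data have coefficients bounded by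
`‖gⁿ‖_∞` up to a constant factor, so they converge beyond `1/ρ₁` because `ρ_∞ < ρ₁`. By Cramer's
rule the kneading determinant times any `L(p)` also converges there (`det_mul_lapSeries_mem`).

Therefore `L(p) / L(]a,b[)` is, to the left of `1/ρ₁`, a quotient of two functions analytic at
`1/ρ₁`, bounded by 1; such a quotient has a limit (`exists_tendsto_lap_div`). The denominator tends
to infinity while the lap function of a point stays bounded, so `x⁻` and `x⁺` have the same limit
`φ(x)`.

In the limit, `φ x - φ y = (s_i g_i / ρ₁) (φ (f_i x) - φ (f_i y))` on `I_i`. This gives the affine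
branches of A. Iterated, it bounds the oscillation of `φ` on a cylinder by `gⁿ/ρ₁ⁿ`, which yields
continuity. For B, admissible words of the model are admissible for the original system; conversely
the images of the cylinders cover `[0,1]` up to finitely many points, so the sum of their lengths
forces `‖gⁿ‖₁ ≥ ρ₁ⁿ` in the model. For C, `φ ∘ F` takes finitely many values on each fibre of `φ`,
which is an interval, so it is constant there and factors through the quotient map `φ`. -/

/-! ### Convergent real power series -/

namespace PowerSeries

/-- The real power series that converge absolutely at `R`. -/
def convergentSubring (R : ℝ) : Subring (PowerSeries ℝ) where
  carrier := {p | Summable fun n => ‖coeff n p * R ^ n‖}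
  mul_mem' := by
    intro p q hp hq
    have h := summable_norm_sum_mul_antidiagonal_of_summable_norm hp hq
    refine h.congr fun n => ?_
    rw [coeff_mul, Finset.sum_mul]
    congr 1
    refine Finset.sum_congr rfl fun x hx => ?_
    rw [← Finset.HasAntidiagonal.mem_antidiagonal.1 hx, pow_add]
    ring
  one_mem' := by
    refine summable_of_ne_finset_zero (s := {0}) fun n hn => ?_
    have : n ≠ 0 := by simpa using hn
    simp [coeff_one, this]
  add_mem' := by
    intro p q hp hq
    refine Summable.of_nonneg_of_le (fun _ => norm_nonneg _) (fun n => ?_) (hp.add hq)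
    rw [map_add, add_mul]
    exact norm_add_le _ _
  zero_mem' := by
    simp only [mem_ofPred_eq, map_zero, zero_mul, norm_zero]
    exact summable_zero
  neg_mem' := by
    intro p hp
    simpa using hp

theorem convergentSubring_anti {r R : ℝ} (hr : 0 ≤ r) (h : r ≤ R) :
    convergentSubring R ≤ convergentSubring r := by
  intro p hp
  refine Summable.of_nonneg_of_le (fun _ => norm_nonneg _) (fun n => ?_) hp
  rw [norm_mul, norm_mul, norm_pow, norm_pow, Real.norm_of_nonneg hr,
    Real.norm_of_nonneg (hr.trans h)]
  gcongr

/-- The sum of a real power series at `t`. -/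
noncomputable def sumAt (t : ℝ) (p : PowerSeries ℝ) : ℝ := ∑' n, coeff n p * t ^ n

theorem sumAt_mul {t : ℝ} {p q : PowerSeries ℝ} (hp : p ∈ convergentSubring t)
    (hq : q ∈ convergentSubring t) : sumAt t (p * q) = sumAt t p * sumAt t q := by
  rw [sumAt, sumAt, sumAt, tsum_mul_tsum_eq_tsum_sum_antidiagonal_of_summable_norm hp hq]
  refine tsum_congr fun n => ?_
  rw [coeff_mul, Finset.sum_mul]
  refine Finset.sum_congr rfl fun x hx => ?_
  rw [← Finset.HasAntidiagonal.mem_antidiagonal.1 hx, pow_add]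
  ring

theorem sumAt_sub {t : ℝ} {p q : PowerSeries ℝ} (hp : p ∈ convergentSubring t)
    (hq : q ∈ convergentSubring t) : sumAt t (p - q) = sumAt t p - sumAt t q := by
  rw [sumAt, sumAt, sumAt, ← hp.of_norm.tsum_sub hq.of_norm]
  refine tsum_congr fun n => ?_
  rw [map_sub, sub_mul]

theorem C_mul_X_mem_convergentSubring (c t : ℝ) : C c * X ∈ convergentSubring t := by
  refine summable_of_ne_finset_zero (s := {1}) fun n hn => ?_
  have : n ≠ 1 := by simpa using hn
  simp [coeff_C_mul, coeff_X, this]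

theorem sumAt_C_mul_X (c t : ℝ) : sumAt t (C c * X) = c * t := by
  rw [sumAt, tsum_eq_single 1]
  · simp
  · intro n hn
    simp [coeff_C_mul, coeff_X, hn]

theorem sumAt_zero_left (p : PowerSeries ℝ) : sumAt 0 p = constantCoeff p := by
  rw [sumAt, tsum_eq_single 0]
  · simp
  · intro n hn
    simp [hn]

theorem analyticAt_sumAt {R t : ℝ} {p : PowerSeries ℝ} (hp : p ∈ convergentSubring R)
    (ht : |t| < R) : AnalyticAt ℝ (fun t => sumAt t p) t := by
  have hR : 0 < R := (abs_nonneg t).trans_lt ht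
  set P := FormalMultilinearSeries.ofScalars ℝ (fun n => coeff n p) with hP
  have hrad : (R.toNNReal : ENNReal) ≤ P.radius := by
    refine P.le_radius_of_summable ?_
    refine hp.congr fun n => ?_
    rw [FormalMultilinearSeries.ofScalars_norm, norm_mul, norm_pow, Real.norm_of_nonneg hR.le,
      Real.coe_toNNReal R hR.le]
  have hpos : 0 < P.radius := lt_of_lt_of_le (by simpa using hR) hrad
  have hball := P.hasFPowerSeriesOnBall hpos
  have hsum : (fun t => sumAt t p) = P.sum := by
    funext t
    have := FormalMultilinearSeries.ofScalars_sum_eq (E := ℝ) (fun n => coeff n p) t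
    rw [FormalMultilinearSeries.ofScalarsSum] at this
    rw [hP, this]
    simp [sumAt]
  rw [hsum]
  refine hball.analyticAt_of_mem (lt_of_lt_of_le ?_ hrad)
  rw [edist_dist, dist_zero_right, Real.norm_eq_abs]
  exact (ENNReal.ofReal_lt_ofReal_iff hR).2 ht

/-- Identity theorem: vanishing near `t` would propagate along `]-R, R[` to the point 0, where the
sum is the constant coefficient. -/
theorem eventually_sumAt_ne_zero {R t : ℝ} {p : PowerSeries ℝ} (hp : p ∈ convergentSubring R)
    (h0 : constantCoeff p ≠ 0) (ht : |t| < R) : ∀ᶠ s in 𝓝[≠] t, sumAt s p ≠ 0 := by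
  have hR : 0 < R := (abs_nonneg t).trans_lt ht
  rcases (analyticAt_sumAt hp ht).eventually_eq_zero_or_eventually_ne_zero with h | h
  · exfalso
    have han : AnalyticOnNhd ℝ (fun t => sumAt t p) (Ioo (-R) R) :=
      fun s hs => analyticAt_sumAt hp (abs_lt.2 hs)
    have := han.eqOn_zero_of_preconnected_of_eventuallyEq_zero isPreconnected_Ioo (abs_lt.1 ht) h
      (show (0 : ℝ) ∈ Ioo (-R) R from ⟨by linarith, hR⟩)
    exact h0 (by simpa [sumAt_zero_left] using this)
  · exact h

end PowerSeries

theorem Matrix.det_mem_subring {A n : Type*} [CommRing A] [Fintype n] [DecidableEq n]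
    (S : Subring A) {M : Matrix n n A} (hM : ∀ i j, M i j ∈ S) : M.det ∈ S := by
  rw [Matrix.det_apply]
  refine S.sum_mem fun σ _ => ?_
  rw [Units.smul_def]
  exact S.zsmul_mem (S.prod_mem fun i _ => hM _ _) _

theorem Matrix.cramer_mem_subring {A n : Type*} [CommRing A] [Fintype n] [DecidableEq n]
    (S : Subring A) {M : Matrix n n A} {v : n → A} (hM : ∀ i j, M i j ∈ S) (hv : ∀ i, v i ∈ S)
    (i : n) : M.cramer v i ∈ S := by
  rw [Matrix.cramer_apply]
  refine Matrix.det_mem_subring S fun j k => ?_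
  rw [Matrix.updateCol_apply]
  split_ifs
  exacts [hv _, hM _ _]

/-- A quotient of functions analytic at `x` that stays bounded to the left of `x` has a limit
from the left. -/
theorem AnalyticAt.exists_tendsto_div_nhdsLT {p q : ℝ → ℝ} {x C : ℝ} (hp : AnalyticAt ℝ p x)
    (hq : AnalyticAt ℝ q x) (hb : ∀ᶠ t in 𝓝[<] x, |p t / q t| ≤ C) :
    ∃ l, Tendsto (fun t => p t / q t) (𝓝[<] x) (𝓝 l) := by
  have hm : MeromorphicAt (p / q) x := hp.meromorphicAt.div hq.meromorphicAt
  have hle : 𝓝[<] x ≤ 𝓝[≠] x := nhdsWithin_mono _ fun y hy => ne_of_lt hy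
  -- A negative order would make the quotient unbounded, against the bound `C`; a non-negative order
  -- gives a limit.
  rcases lt_or_ge (meromorphicOrderAt (p / q) x) 0 with h | h
  · exfalso
    have h1 := (tendsto_cobounded_of_meromorphicOrderAt_neg h).mono_left hle
    have h2 := (tendsto_norm_atTop_iff_cobounded.2 h1).eventually_gt_atTop C
    obtain ⟨t, ht, ht'⟩ := (hb.and h2).exists
    simp only [Pi.div_apply, Real.norm_eq_abs] at ht'
    linarith
  · obtain ⟨l, hl⟩ := (tendsto_nhds_iff_meromorphicOrderAt_nonneg hm).2 h
    exact ⟨l, hl.mono_left hle⟩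

/-! ### Exponential growth rates -/

theorem isBoundedUnder_rpow_one_div {u : ℕ → ℝ} {M : ℝ} (hM : 0 ≤ M) (h0 : ∀ n, 0 ≤ u n)
    (h : ∀ n, u n ≤ M ^ n) :
    IsBoundedUnder (· ≤ ·) atTop fun n : ℕ => u n ^ (1 / (n : ℝ)) := by
  refine isBoundedUnder_of_eventually_le (a := M) ?_
  filter_upwards [eventually_gt_atTop 0] with n hn
  calc u n ^ (1 / (n : ℝ)) ≤ (M ^ n) ^ (1 / (n : ℝ)) :=
        Real.rpow_le_rpow (h0 n) (h n) (by positivity)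
    _ = M := by rw [one_div, Real.pow_rpow_inv_natCast hM hn.ne']

theorem isCoboundedUnder_rpow_one_div {u : ℕ → ℝ} (h0 : ∀ n, 0 ≤ u n) :
    IsCoboundedUnder (· ≤ ·) atTop fun n : ℕ => u n ^ (1 / (n : ℝ)) :=
  (isBoundedUnder_of_eventually_ge (a := (0 : ℝ))
    (Eventually.of_forall fun n => Real.rpow_nonneg (h0 n) _)).isCoboundedUnder_le

theorem eventually_le_pow_of_limsup_lt {u : ℕ → ℝ} {M r : ℝ} (hM : 0 ≤ M) (h0 : ∀ n, 0 ≤ u n)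
    (h : ∀ n, u n ≤ M ^ n) (hr : limsup (fun n : ℕ => u n ^ (1 / (n : ℝ))) atTop < r) :
    ∀ᶠ n in atTop, u n ≤ r ^ n := by
  have := eventually_lt_of_limsup_lt hr (isBoundedUnder_rpow_one_div hM h0 h)
  filter_upwards [this, eventually_gt_atTop 0] with n h1 hn
  have h2 : u n = (u n ^ (1 / (n : ℝ))) ^ n := by
    rw [one_div, Real.rpow_inv_natCast_pow (h0 n) hn.ne']
  rw [h2]
  exact pow_le_pow_left₀ (Real.rpow_nonneg (h0 n) _) h1.le n

theorem limsup_le_of_eventually_le_pow {u : ℕ → ℝ} {r : ℝ} (hr : 0 ≤ r) (h0 : ∀ n, 0 ≤ u n)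
    (h : ∀ᶠ n in atTop, u n ≤ r ^ n) :
    limsup (fun n : ℕ => u n ^ (1 / (n : ℝ))) atTop ≤ r := by
  refine limsup_le_of_le (isCoboundedUnder_rpow_one_div h0) ?_
  filter_upwards [h, eventually_gt_atTop 0] with n h1 hn
  calc u n ^ (1 / (n : ℝ)) ≤ (r ^ n) ^ (1 / (n : ℝ)) :=
        Real.rpow_le_rpow (h0 n) h1 (by positivity)
    _ = r := by rw [one_div, Real.pow_rpow_inv_natCast hr hn.ne']

theorem le_limsup_of_pow_le {u : ℕ → ℝ} {M r : ℝ} (hM : 0 ≤ M) (hr : 0 ≤ r)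
    (h0 : ∀ n, 0 ≤ u n) (h : ∀ n, u n ≤ M ^ n) (hl : ∀ n, r ^ n ≤ u n) :
    r ≤ limsup (fun n : ℕ => u n ^ (1 / (n : ℝ))) atTop := by
  refine le_limsup_of_frequently_le ?_ (isBoundedUnder_rpow_one_div hM h0 h)
  refine Eventually.frequently ?_
  filter_upwards [eventually_gt_atTop 0] with n hn
  calc r = (r ^ n) ^ (1 / (n : ℝ)) := by rw [one_div, Real.pow_rpow_inv_natCast hr hn.ne']
    _ ≤ u n ^ (1 / (n : ℝ)) := Real.rpow_le_rpow (by positivity) (hl n) (by positivity)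

/-- A submultiplicative sequence lies above the powers of its growth rate. -/
theorem limsup_pow_le_of_submultiplicative {u : ℕ → ℝ} (h0 : ∀ n, 0 ≤ u n) (hone : 1 ≤ u 0)
    (hmul : ∀ m n, u (m + n) ≤ u m * u n)
    (hρ0 : 0 ≤ limsup (fun n : ℕ => u n ^ (1 / (n : ℝ))) atTop) (m : ℕ) :
    limsup (fun n : ℕ => u n ^ (1 / (n : ℝ))) atTop ^ m ≤ u m := by
  set ρ := limsup (fun n : ℕ => u n ^ (1 / (n : ℝ))) atTop with hρ
  rcases Nat.eq_zero_or_pos m with rfl | hm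
  · simpa using hone
  by_contra! hlt
  set v := u m ^ (1 / (m : ℝ)) with hv
  have hv0 : 0 ≤ v := Real.rpow_nonneg (h0 m) _
  have hvm : v ^ m = u m := by rw [hv, one_div, Real.rpow_inv_natCast_pow (h0 m) hm.ne']
  have hvρ : v < ρ := lt_of_pow_lt_pow_left₀ m hρ0 (hvm ▸ hlt)
  -- Two rates are needed: `q` serves the induction by blocks of length `m`, which produces `C * q ^
  -- n`, and the larger `q'` absorbs the constant `C`.
  obtain ⟨q, hvq, hqρ⟩ := exists_between hvρ
  obtain ⟨q', hqq, hqρ'⟩ := exists_between hqρ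
  have hq : 0 < q := hv0.trans_lt hvq
  obtain ⟨C, hC⟩ : ∃ C : ℝ, ∀ n < m, u n ≤ C * q ^ n := by
    refine ⟨∑ n ∈ Finset.range m, u n / q ^ n, fun n hn => ?_⟩
    rw [← div_le_iff₀ (by positivity)]
    exact Finset.single_le_sum (f := fun n => u n / q ^ n)
      (fun i _ => div_nonneg (h0 i) (by positivity)) (Finset.mem_range.2 hn)
  have hall : ∀ n, u n ≤ C * q ^ n := by
    intro n
    induction n using Nat.strong_induction_on with
    | _ n ih =>
      rcases lt_or_ge n m with h | h
      · exact hC n h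
      · obtain ⟨k, rfl⟩ := Nat.exists_eq_add_of_le h
        calc u (m + k) ≤ u m * u k := hmul m k
          _ ≤ q ^ m * (C * q ^ k) := by
            refine mul_le_mul ?_ (ih k (by omega)) (h0 k) (by positivity)
            rw [← hvm]
            exact pow_le_pow_left₀ hv0 hvq.le m
          _ = C * q ^ (m + k) := by ring
  have htend : Tendsto (fun n : ℕ => C * (q / q') ^ n) atTop (𝓝 0) := by
    simpa using (tendsto_pow_atTop_nhds_zero_of_lt_one (div_nonneg hq.le (hq.trans hqq).le)
      ((div_lt_one (hq.trans hqq)).2 hqq)).const_mul C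
  have hle : ρ ≤ q' := by
    refine limsup_le_of_eventually_le_pow (hq.trans hqq).le h0 ?_
    filter_upwards [htend.eventually_le_const zero_lt_one] with n hn
    refine (hall n).trans ?_
    have hq' : 0 < q' ^ n := pow_pos (hq.trans hqq) n
    rw [div_pow, ← mul_div_assoc, div_le_one hq'] at hn
    exact hn
  linarith

/-! ### Admissible words and the growth of their weights -/

namespace BranchSystem

variable {ι : Type} (F : BranchSystem ι)

/-- The recursive definition peels off only the first letter; in terms of orbits, prefixes and
suffixes of a word are treated alike. Only the values `y 0, …, y n` are constrained. -/
theorem mem_cylinder_iff {n : ℕ} {w : Fin n → ι} {x : ℝ} :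
    x ∈ F.cylinder n w ↔ ∃ y : ℕ → ℝ, y 0 = x ∧
      ∀ k : Fin n, y k ∈ F.dom (w k) ∧ y (k + 1) = F.map (w k) (y k) := by
  induction n generalizing x with
  | zero => simp only [cylinder, mem_univ, true_iff]; exact ⟨fun _ => x, rfl, fun k => k.elim0⟩
  | succ n ih =>
    simp only [cylinder, mem_inter_iff, mem_preimage, ih]
    constructor
    · rintro ⟨hx, y, hy0, hy⟩
      refine ⟨fun k => Nat.casesOn k x y, rfl, fun k => ?_⟩
      refine Fin.cases ?_ (fun k => ?_) k
      · exact ⟨hx, hy0⟩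
      · exact hy k
    · rintro ⟨y, rfl, hy⟩
      exact ⟨(hy 0).1, fun k => y (k + 1), (hy 0).2, fun k => hy k.succ⟩

theorem cylinder_nonempty_castAdd {m n : ℕ} {w : Fin (m + n) → ι}
    (h : (F.cylinder (m + n) w).Nonempty) :
    (F.cylinder m fun k => w (k.castAdd n)).Nonempty := by
  obtain ⟨x, hx⟩ := h
  obtain ⟨y, -, hy⟩ := F.mem_cylinder_iff.1 hx
  exact ⟨y 0, F.mem_cylinder_iff.2 ⟨y, rfl, fun k => by simpa using hy (k.castAdd n)⟩⟩

theorem cylinder_nonempty_natAdd {m n : ℕ} {w : Fin (m + n) → ι}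
    (h : (F.cylinder (m + n) w).Nonempty) :
    (F.cylinder n fun k => w (k.natAdd m)).Nonempty := by
  obtain ⟨x, hx⟩ := h
  obtain ⟨y, -, hy⟩ := F.mem_cylinder_iff.1 hx
  exact ⟨y m, F.mem_cylinder_iff.2 ⟨fun k => y (m + k), rfl, fun k => by
    simpa [add_assoc] using hy (k.natAdd m)⟩⟩

theorem wordWeight_cons {n : ℕ} (i : ι) (w : Fin n → ι) :
    F.wordWeight (Fin.cons i w : Fin (n + 1) → ι) = F.weight i * F.wordWeight w := by
  simp [wordWeight, Fin.prod_univ_succ]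

theorem wordWeight_nonneg (hw : ∀ i, 0 ≤ F.weight i) {n : ℕ} (w : Fin n → ι) :
    0 ≤ F.wordWeight w := Finset.prod_nonneg fun _ _ => hw _

variable [Fintype ι]

theorem mem_Z {n : ℕ} {w : Fin n → ι} : w ∈ F.Z n ↔ (F.cylinder n w).Nonempty := by
  simp [Z]

theorem init_mem_Z {n : ℕ} {w : Fin (n + 1) → ι} (h : w ∈ F.Z (n + 1)) :
    Fin.init w ∈ F.Z n :=
  F.mem_Z.2 (F.cylinder_nonempty_castAdd (F.mem_Z.1 h))

theorem abs_wordWeight_le_normInf {n : ℕ} {w : Fin n → ι} (h : w ∈ F.Z n) :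
    |F.wordWeight w| ≤ F.normInf n :=
  le_ciSup (f := fun w : {w // w ∈ F.Z n} => |F.wordWeight w.1|)
    (Set.finite_range _).bddAbove ⟨w, h⟩

theorem normInf_nonneg (n : ℕ) : 0 ≤ F.normInf n := Real.iSup_nonneg fun _ => abs_nonneg _

theorem normOne_nonneg (n : ℕ) : 0 ≤ F.normOne n := Finset.sum_nonneg fun _ _ => abs_nonneg _

theorem normInf_le_normOne (n : ℕ) : F.normInf n ≤ F.normOne n :=
  Real.iSup_le (fun w => Finset.single_le_sum (f := fun w => |F.wordWeight w|)
    (fun _ _ => abs_nonneg _) w.2) (F.normOne_nonneg n)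

theorem normOne_le_pow (n : ℕ) : F.normOne n ≤ (∑ i, |F.weight i|) ^ n := by
  rw [Fintype.sum_pow]
  refine (Finset.sum_le_univ_sum_of_nonneg fun w => abs_nonneg _).trans_eq ?_
  exact Finset.sum_congr rfl fun w _ => Finset.abs_prod _ _

theorem sum_abs_weight_nonneg : 0 ≤ ∑ i, |F.weight i| := Finset.sum_nonneg fun _ _ => abs_nonneg _

theorem eventually_normInf_le_pow {r : ℝ} (hr : F.rhoInf < r) :
    ∀ᶠ n in atTop, F.normInf n ≤ r ^ n :=
  eventually_le_pow_of_limsup_lt F.sum_abs_weight_nonneg F.normInf_nonneg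
    (fun n => (F.normInf_le_normOne n).trans (F.normOne_le_pow n)) hr

theorem eventually_normOne_le_pow {r : ℝ} (hr : F.rhoOne < r) :
    ∀ᶠ n in atTop, F.normOne n ≤ r ^ n :=
  eventually_le_pow_of_limsup_lt F.sum_abs_weight_nonneg F.normOne_nonneg F.normOne_le_pow hr

theorem rhoInf_nonneg : 0 ≤ F.rhoInf := by
  refine le_limsup_of_frequently_le (Frequently.of_forall fun n => ?_)
    (isBoundedUnder_rpow_one_div F.sum_abs_weight_nonneg F.normInf_nonneg
    (fun n => (F.normInf_le_normOne n).trans (F.normOne_le_pow n)))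
  exact Real.rpow_nonneg (F.normInf_nonneg n) _

theorem normOne_zero : F.normOne 0 = 1 := by
  have : F.Z 0 = Finset.univ := by
    ext w
    simp only [mem_Z, cylinder, univ_nonempty, Finset.mem_univ]
  simp [normOne, this, wordWeight]

/-- Cutting an admissible word after `m` letters leaves two admissible words and is injective; not
every pair arises in this way, whence only an inequality. -/
theorem normOne_add_le (m n : ℕ) : F.normOne (m + n) ≤ F.normOne m * F.normOne n := by
  classical
  set e : (Fin (m + n) → ι) → (Fin m → ι) × (Fin n → ι) :=
    fun w => (fun k => w (k.castAdd n), fun k => w (k.natAdd m)) with he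
  have hinj : Function.Injective e := (Fin.appendEquiv m n).symm.injective
  calc F.normOne (m + n)
      = ∑ w ∈ F.Z (m + n), |F.wordWeight (e w).1| * |F.wordWeight (e w).2| := by
        refine Finset.sum_congr rfl fun w _ => ?_
        rw [← abs_mul, wordWeight, Fin.prod_univ_add]
        rfl
    _ = ∑ p ∈ (F.Z (m + n)).image e, |F.wordWeight p.1| * |F.wordWeight p.2| :=
        by rw [Finset.sum_image hinj.injOn]
    _ ≤ ∑ p ∈ F.Z m ×ˢ F.Z n, |F.wordWeight p.1| * |F.wordWeight p.2| := by
        refine Finset.sum_le_sum_of_subset_of_nonneg ?_ fun _ _ _ => by positivity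
        intro p hp
        obtain ⟨w, hw, rfl⟩ := Finset.mem_image.1 hp
        rw [mem_Z] at hw
        exact Finset.mem_product.2 ⟨F.mem_Z.2 (F.cylinder_nonempty_castAdd hw),
          F.mem_Z.2 (F.cylinder_nonempty_natAdd hw)⟩
    _ = F.normOne m * F.normOne n := by
        rw [normOne, normOne, Finset.sum_mul_sum, ← Finset.sum_product']

theorem rhoOne_nonneg : 0 ≤ F.rhoOne := by
  refine le_limsup_of_frequently_le (Frequently.of_forall fun n => ?_)
    (isBoundedUnder_rpow_one_div F.sum_abs_weight_nonneg F.normOne_nonneg F.normOne_le_pow)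
  exact Real.rpow_nonneg (F.normOne_nonneg n) _

/-- The limsup alone would give lower bounds for infinitely many `n` only; submultiplicativity gives
this one for every `n`. -/
theorem rhoOne_pow_le_normOne (n : ℕ) : F.rhoOne ^ n ≤ F.normOne n :=
  limsup_pow_le_of_submultiplicative F.normOne_nonneg F.normOne_zero.ge F.normOne_add_le
    F.rhoOne_nonneg n

end BranchSystem

/-! ### Preimages of open intervals under strictly monotone maps -/

theorem IsOpen.eq_Ioo_csInf_csSup {V : Set ℝ} (ho : IsOpen V) (hc : V.OrdConnected)
    (hne : V.Nonempty) (hb : BddBelow V) (ha : BddAbove V) : V = Ioo (sInf V) (sSup V) := by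
  apply Subset.antisymm
  · intro x hx
    obtain ⟨l, u, hxm, hsub⟩ := mem_nhds_iff_exists_Ioo_subset.1 (ho.mem_nhds hx)
    obtain ⟨y, hy1, hy2⟩ := exists_between hxm.1
    obtain ⟨z, hz1, hz2⟩ := exists_between hxm.2
    exact ⟨(csInf_le hb (hsub ⟨hy1, hy2.trans hxm.2⟩)).trans_lt hy2,
      hz1.trans_le (le_csSup ha (hsub ⟨hxm.1.trans hz1, hz2⟩))⟩
  · intro x hx
    obtain ⟨y, hy, hyx⟩ := exists_lt_of_csInf_lt hne hx.1
    obtain ⟨z, hz, hxz⟩ := exists_lt_of_lt_csSup hne hx.2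
    exact hc.out hy hz ⟨hyx.le, hxz.le⟩

section Preimage

variable {f : ℝ → ℝ} {c d u v x : ℝ}

/-- Since `x` is interior to the domain, it cannot be an end of the preimage merely because the
domain stops at `c`. Non-emptiness is part of the claim because `sInf ∅` is the junk value 0. -/
theorem StrictMonoOn.csInf_preimage_Ioo_iff (hm : StrictMonoOn f (Ioo c d))
    (hf : ContinuousOn f (Ioo c d)) (huv : u < v) (hx : x ∈ Ioo c d) :
    ((Ioo c d ∩ f ⁻¹' Ioo u v).Nonempty ∧ sInf (Ioo c d ∩ f ⁻¹' Ioo u v) = x) ↔ f x = u := by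
  set V := Ioo c d ∩ f ⁻¹' Ioo u v with hV
  have hfx : ContinuousAt f x := hf.continuousAt (Ioo_mem_nhds hx.1 hx.2)
  have hbdd : BddBelow V := ⟨c, fun y hy => hy.1.1.le⟩
  have hopen : IsOpen V := hf.isOpen_inter_preimage isOpen_Ioo isOpen_Ioo
  constructor
  · rintro ⟨hne, hinf⟩
    have hxV : x ∉ V := by
      intro hxV
      obtain ⟨l, w, hxm, hsub⟩ := mem_nhds_iff_exists_Ioo_subset.1 (hopen.mem_nhds hxV)
      obtain ⟨y, hy1, hy2⟩ := exists_between hxm.1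
      have := csInf_le hbdd (hsub ⟨hy1, hy2.trans hxm.2⟩)
      linarith
    obtain ⟨y, hy⟩ := hne
    have hxy : x ≤ y := hinf ▸ csInf_le hbdd hy
    have hxy' : x < y := lt_of_le_of_ne hxy fun h => hxV (h ▸ hy)
    have hfv : f x < v := (hm hx hy.1 hxy').trans hy.2.2
    refine le_antisymm ?_ ?_
    · by_contra! h
      exact hxV ⟨hx, h, hfv⟩
    · have hcl : x ∈ closure V := hinf ▸ csInf_mem_closure ⟨y, hy⟩ hbdd
      have : MapsTo f V (Ici u) := fun z hz => hz.2.1.le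
      have h2 : f x ∈ closure (Ici u) := hfx.continuousWithinAt.mem_closure hcl this
      rwa [isClosed_Ici.closure_eq] at h2
  · intro hfu
    have hev : ∀ᶠ y in 𝓝[>] x, y ∈ V := by
      have h1 : ∀ᶠ y in 𝓝 x, f y < v := hfx.eventually_lt_const (hfu ▸ huv)
      have h2 : ∀ᶠ y in 𝓝 x, y ∈ Ioo c d := Ioo_mem_nhds hx.1 hx.2
      filter_upwards [h1.filter_mono nhdsWithin_le_nhds, h2.filter_mono nhdsWithin_le_nhds,
        self_mem_nhdsWithin] with y h1 h2 h3
      exact ⟨h2, hfu ▸ hm hx h2 h3, h1⟩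
    refine ⟨hev.exists, le_antisymm ?_ ?_⟩
    · refine le_of_forall_gt fun z hz => ?_
      obtain ⟨y, hy, hyz⟩ := (hev.and (Ioo_mem_nhdsGT hz)).exists
      exact (csInf_le hbdd hy).trans_lt hyz.2
    · refine le_csInf hev.exists fun y hy => ?_
      by_contra! h
      have := hm hy.1 hx h
      have := hy.2.1
      linarith

theorem StrictMonoOn.csSup_preimage_Ioo_iff (hm : StrictMonoOn f (Ioo c d))
    (hf : ContinuousOn f (Ioo c d)) (huv : u < v) (hx : x ∈ Ioo c d) :
    ((Ioo c d ∩ f ⁻¹' Ioo u v).Nonempty ∧ sSup (Ioo c d ∩ f ⁻¹' Ioo u v) = x) ↔ f x = v := by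
  have hmaps : MapsTo (fun y : ℝ => -y) (Ioo (-d) (-c)) (Ioo c d) := fun y hy =>
    ⟨by linarith [hy.2], by linarith [hy.1]⟩
  have hm' : StrictMonoOn (fun y => -f (-y)) (Ioo (-d) (-c)) := fun y hy z hz hyz =>
    neg_lt_neg (hm (hmaps hz) (hmaps hy) (neg_lt_neg hyz))
  have hf' : ContinuousOn (fun y => -f (-y)) (Ioo (-d) (-c)) :=
    (hf.comp continuous_neg.continuousOn hmaps).neg
  have key := hm'.csInf_preimage_Ioo_iff hf' (neg_lt_neg huv) (x := -x)
    ⟨neg_lt_neg hx.2, neg_lt_neg hx.1⟩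
  have hset : Ioo (-d) (-c) ∩ (fun y => -f (-y)) ⁻¹' Ioo (-v) (-u) =
      -(Ioo c d ∩ f ⁻¹' Ioo u v) := by
    ext y
    simp only [mem_inter_iff, mem_Ioo, mem_preimage, Set.mem_neg, neg_lt_neg_iff]
    constructor <;> rintro ⟨⟨h1, h2⟩, h3, h4⟩ <;> refine ⟨⟨?_, ?_⟩, ?_, ?_⟩ <;> linarith
  rw [hset, Set.nonempty_neg, Real.sInf_neg, neg_inj, neg_neg, neg_inj] at key
  exact key

theorem StrictAntiOn.csInf_preimage_Ioo_iff (hm : StrictAntiOn f (Ioo c d))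
    (hf : ContinuousOn f (Ioo c d)) (huv : u < v) (hx : x ∈ Ioo c d) :
    ((Ioo c d ∩ f ⁻¹' Ioo u v).Nonempty ∧ sInf (Ioo c d ∩ f ⁻¹' Ioo u v) = x) ↔ f x = v := by
  have key := StrictMonoOn.csInf_preimage_Ioo_iff (f := fun y => -f y) (u := -v) (v := -u)
    hm.neg hf.neg (neg_lt_neg huv) hx
  have hset : (fun y => -f y) ⁻¹' Ioo (-v) (-u) = f ⁻¹' Ioo u v := by
    ext y
    simp [and_comm]
  rwa [hset, neg_inj] at key

theorem StrictAntiOn.csSup_preimage_Ioo_iff (hm : StrictAntiOn f (Ioo c d))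
    (hf : ContinuousOn f (Ioo c d)) (huv : u < v) (hx : x ∈ Ioo c d) :
    ((Ioo c d ∩ f ⁻¹' Ioo u v).Nonempty ∧ sSup (Ioo c d ∩ f ⁻¹' Ioo u v) = x) ↔ f x = u := by
  have key := StrictMonoOn.csSup_preimage_Ioo_iff (f := fun y => -f y) (u := -v) (v := -u)
    hm.neg hf.neg (neg_lt_neg huv) hx
  have hset : (fun y => -f y) ⁻¹' Ioo (-v) (-u) = f ⁻¹' Ioo u v := by
    ext y
    simp [and_comm]
  rwa [hset, neg_inj] at key

end Preimage

/-! ### Counting end points of cylinders -/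

open Classical in
/-- The number of end points in `J` of the interval `V`. -/
noncomputable def endCount (J V : Set ℝ) : ℝ :=
  (if V.Nonempty ∧ sInf V ∈ J then 1 else 0) + if V.Nonempty ∧ sSup V ∈ J then 1 else 0

theorem endCount_nonneg (J V : Set ℝ) : 0 ≤ endCount J V := by
  rw [endCount]
  split_ifs <;> norm_num

theorem endCount_mono {J K : Set ℝ} (h : J ⊆ K) (V : Set ℝ) : endCount J V ≤ endCount K V := by
  rw [endCount, endCount]
  gcongr ?_ + ?_ <;>
  · split_ifs with h1 h2
    · exact le_rfl
    · exact absurd ⟨h1.1, h h1.2⟩ h2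
    · exact zero_le_one
    · exact le_rfl

theorem endCount_diff {J K : Set ℝ} (h : J ⊆ K) (V : Set ℝ) :
    endCount (K \ J) V = endCount K V - endCount J V := by
  have key : ∀ y, y ∈ J → y ∈ K := h
  have h1 := key (sInf V)
  have h2 := key (sSup V)
  simp only [endCount, Set.mem_sdiff]
  by_cases hV : V.Nonempty <;> by_cases h3 : sInf V ∈ J <;> by_cases h4 : sSup V ∈ J <;>
    by_cases h5 : sInf V ∈ K <;> by_cases h6 : sSup V ∈ K <;> simp_all

/-- As `J` avoids `c` and `d`, every end of the preimage in `J` comes from an end of `U`. A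
decreasing map exchanges the two ends, which does not affect the total. -/
theorem endCount_preimage {f : ℝ → ℝ} {c d : ℝ} {J U : Set ℝ}
    (hf : ContinuousOn f (Ioo c d)) (hm : StrictMonoOn f (Ioo c d) ∨ StrictAntiOn f (Ioo c d))
    (hJ : J ⊆ Ioo c d) (ho : IsOpen U) (hc : U.OrdConnected) (hb : BddBelow U)
    (ha : BddAbove U) : endCount J (Ioo c d ∩ f ⁻¹' U) = endCount (f '' J) U := by
  classical
  rcases U.eq_empty_or_nonempty with rfl | hne
  · simp [endCount]
  have hU := ho.eq_Ioo_csInf_csSup hc hne hb ha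
  set u := sInf U with hu
  set v := sSup U with hv
  have huv : u < v := by
    rw [hU] at hne
    exact nonempty_Ioo.1 hne
  have aux : ∀ (V : Set ℝ) (y z : ℝ), (∀ x ∈ Ioo c d, (V.Nonempty ∧ y = x) ↔ f x = z) →
      ((V.Nonempty ∧ y ∈ J) ↔ (U.Nonempty ∧ z ∈ f '' J)) := by
    intro V y z h
    constructor
    · rintro ⟨h1, h2⟩
      exact ⟨hne, y, h2, (h y (hJ h2)).1 ⟨h1, rfl⟩⟩
    · rintro ⟨-, x, hx, hxz⟩
      obtain ⟨h1, rfl⟩ := (h x (hJ hx)).2 hxz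
      exact ⟨h1, hx⟩
  rw [endCount, endCount, ← hu, ← hv]
  rcases hm with hm | hm
  · have h1 := aux (Ioo c d ∩ f ⁻¹' U) (sInf (Ioo c d ∩ f ⁻¹' U)) u fun x hx => by
      rw [hU]; exact hm.csInf_preimage_Ioo_iff hf huv hx
    have h2 := aux (Ioo c d ∩ f ⁻¹' U) (sSup (Ioo c d ∩ f ⁻¹' U)) v fun x hx => by
      rw [hU]; exact hm.csSup_preimage_Ioo_iff hf huv hx
    exact congrArg₂ _ (if_congr h1 rfl rfl) (if_congr h2 rfl rfl)
  · have h1 := aux (Ioo c d ∩ f ⁻¹' U) (sInf (Ioo c d ∩ f ⁻¹' U)) v fun x hx => by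
      rw [hU]; exact hm.csInf_preimage_Ioo_iff hf huv hx
    have h2 := aux (Ioo c d ∩ f ⁻¹' U) (sSup (Ioo c d ∩ f ⁻¹' U)) u fun x hx => by
      rw [hU]; exact hm.csSup_preimage_Ioo_iff hf huv hx
    rw [add_comm]
    exact congrArg₂ _ (if_congr h2 rfl rfl) (if_congr h1 rfl rfl)

/-- Empty cylinders count zero, so the sum may run over all words and be re-indexed without
admissibility conditions. -/
theorem BranchSystem.lapCoeff_eq_sum_endCount {ι : Type} [Fintype ι] (F : BranchSystem ι)
    (J : Set ℝ) (n : ℕ) :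
    F.lapCoeff J n = 1 / 2 * ∑ w : Fin (n + 1) → ι,
      F.wordWeight (Fin.init w) * endCount J (F.cylinder (n + 1) w) := by
  classical
  rw [BranchSystem.lapCoeff, BranchSystem.Z, Finset.sum_filter]
  congr 1
  refine Finset.sum_congr rfl fun w _ => ?_
  by_cases h : (F.cylinder (n + 1) w).Nonempty
  · simp [endCount, h, Set.indicator_apply]
  · simp [endCount, h]

theorem BranchSystem.lapCoeff_nonneg {ι : Type} [Fintype ι] (F : BranchSystem ι)
    (hw : ∀ i, 0 ≤ F.weight i) (J : Set ℝ) (n : ℕ) : 0 ≤ F.lapCoeff J n := by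
  rw [F.lapCoeff_eq_sum_endCount]
  exact mul_nonneg (by norm_num) (Finset.sum_nonneg fun w _ =>
    mul_nonneg (F.wordWeight_nonneg hw _) (endCount_nonneg _ _))

theorem BranchSystem.lapCoeff_mono {ι : Type} [Fintype ι] (F : BranchSystem ι)
    (hw : ∀ i, 0 ≤ F.weight i) {J K : Set ℝ} (h : J ⊆ K) (n : ℕ) :
    F.lapCoeff J n ≤ F.lapCoeff K n := by
  rw [F.lapCoeff_eq_sum_endCount, F.lapCoeff_eq_sum_endCount]
  gcongr with w
  · exact F.wordWeight_nonneg hw _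
  · exact endCount_mono h _

theorem BranchSystem.lapCoeff_diff {ι : Type} [Fintype ι] (F : BranchSystem ι)
    {J K : Set ℝ} (h : J ⊆ K) (n : ℕ) :
    F.lapCoeff (K \ J) n = F.lapCoeff K n - F.lapCoeff J n := by
  simp only [F.lapCoeff_eq_sum_endCount, endCount_diff h, mul_sub, Finset.sum_sub_distrib]

/-! ### Cylinders of a weighted system and their lap coefficients -/

namespace WeightedSystem

variable {a b : ℝ} {ℓ : ℕ} (W : WeightedSystem a b ℓ)

theorem cut_lt_cut_succ (i : Fin (ℓ + 1)) : W.cut i.castSucc < W.cut i.succ :=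
  W.cut_strictMono i.castSucc_lt_succ

theorem le_cut (k : Fin (ℓ + 2)) : a ≤ W.cut k :=
  W.cut_zero.symm.trans_le (W.cut_strictMono.monotone (Fin.zero_le k))

theorem cut_le (k : Fin (ℓ + 2)) : W.cut k ≤ b := by
  have := W.cut_strictMono.monotone (Fin.le_last k)
  rwa [W.cut_last] at this

theorem left_lt_right (W : WeightedSystem a b ℓ) : a < b := by
  have := W.cut_strictMono (show (0 : Fin (ℓ + 2)) < Fin.last (ℓ + 1) from Fin.last_pos)
  rwa [W.cut_zero, W.cut_last] at this

theorem Icc_cut_subset (i : Fin (ℓ + 1)) : Icc (W.cut i.castSucc) (W.cut i.succ) ⊆ Icc a b :=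
  Icc_subset_Icc (W.le_cut _) (W.cut_le _)

theorem I_subset_Ioo (i : Fin (ℓ + 1)) : W.I i ⊆ Ioo a b :=
  Ioo_subset_Ioo (W.le_cut _) (W.cut_le _)

theorem succ_cut_le_of_lt {i j : Fin (ℓ + 1)} (h : i < j) : W.cut i.succ ≤ W.cut j.castSucc :=
  W.cut_strictMono.monotone (by rw [Fin.le_def]; simpa using h)

theorem eq_of_mem_I_of_mem_Icc {i j : Fin (ℓ + 1)} {x : ℝ} (hi : x ∈ W.I i)
    (hj : x ∈ Icc (W.cut j.castSucc) (W.cut j.succ)) : i = j := by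
  rcases lt_trichotomy i j with h | h | h
  · have := W.succ_cut_le_of_lt h
    linarith [hi.2, hj.1]
  · exact h
  · have := W.succ_cut_le_of_lt h
    linarith [hi.1, hj.2]

theorem cut_notMem_I (k : Fin (ℓ + 2)) (i : Fin (ℓ + 1)) : W.cut k ∉ W.I i := by
  rintro ⟨h1, h2⟩
  rw [W.cut_strictMono.lt_iff_lt, Fin.lt_def] at h1 h2
  simp only [Fin.val_castSucc, Fin.val_succ] at h1 h2
  omega

theorem exists_mem_Ico {x : ℝ} (hx : x ∈ Ico a b) :
    ∃ i : Fin (ℓ + 1), x ∈ Ico (W.cut i.castSucc) (W.cut i.succ) := by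
  have key : ∀ k : Fin (ℓ + 2), x < W.cut k →
      ∃ i : Fin (ℓ + 1), x ∈ Ico (W.cut i.castSucc) (W.cut i.succ) := by
    intro k
    induction k using Fin.induction with
    | zero => intro h; rw [W.cut_zero] at h; exact absurd hx.1 (not_le.2 h)
    | succ i ih =>
      intro h
      rcases lt_or_ge x (W.cut i.castSucc) with h' | h'
      · exact ih h'
      · exact ⟨i, h', h⟩
  exact key (Fin.last _) (W.cut_last.symm ▸ hx.2)

theorem exists_mem_Ioc {x : ℝ} (hx : x ∈ Ioc a b) :
    ∃ i : Fin (ℓ + 1), x ∈ Ioc (W.cut i.castSucc) (W.cut i.succ) := by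
  have key : ∀ k : Fin (ℓ + 2), x ≤ W.cut k →
      ∃ i : Fin (ℓ + 1), x ∈ Ioc (W.cut i.castSucc) (W.cut i.succ) := by
    intro k
    induction k using Fin.induction with
    | zero => intro h; rw [W.cut_zero] at h; exact absurd hx.1 (not_lt.2 h)
    | succ i ih =>
      intro h
      rcases le_or_gt x (W.cut i.castSucc) with h' | h'
      · exact ih h'
      · exact ⟨i, h', h⟩
  exact key (Fin.last _) (W.cut_last.symm ▸ hx.2)

theorem isOpen_cylinder (n : ℕ) (w : Fin n → Fin (ℓ + 1)) : IsOpen (W.branches.cylinder n w) := by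
  induction n with
  | zero => exact isOpen_univ
  | succ n ih => exact (W.f_continuousOn (w 0)).isOpen_inter_preimage isOpen_Ioo (ih _)

theorem ordConnected_cylinder (n : ℕ) (w : Fin n → Fin (ℓ + 1)) :
    (W.branches.cylinder n w).OrdConnected := by
  induction n with
  | zero => exact ordConnected_univ
  | succ n ih =>
    refine ⟨fun x hx y hy z hz => ?_⟩
    have hzI : z ∈ W.I (w 0) := ordConnected_Ioo.out hx.1 hy.1 hz
    refine ⟨hzI, ?_⟩
    rcases W.f_strict (w 0) with h | h
    · exact (ih _).out hx.2 hy.2 ⟨h.monotoneOn hx.1 hzI hz.1, h.monotoneOn hzI hy.1 hz.2⟩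
    · exact (ih _).out hy.2 hx.2 ⟨h.antitoneOn hzI hy.1 hz.2, h.antitoneOn hx.1 hzI hz.1⟩

theorem cylinder_succ_subset_I {n : ℕ} (w : Fin (n + 1) → Fin (ℓ + 1)) :
    W.branches.cylinder (n + 1) w ⊆ W.I (w 0) := inter_subset_left

theorem bddBelow_cylinder {n : ℕ} (w : Fin (n + 1) → Fin (ℓ + 1)) :
    BddBelow (W.branches.cylinder (n + 1) w) :=
  bddBelow_Ioo.mono (W.cylinder_succ_subset_I w)

theorem bddAbove_cylinder {n : ℕ} (w : Fin (n + 1) → Fin (ℓ + 1)) :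
    BddAbove (W.branches.cylinder (n + 1) w) :=
  bddAbove_Ioo.mono (W.cylinder_succ_subset_I w)

theorem cylinder_eq_Ioo {n : ℕ} {w : Fin (n + 1) → Fin (ℓ + 1)}
    (h : (W.branches.cylinder (n + 1) w).Nonempty) :
    W.branches.cylinder (n + 1) w =
      Ioo (sInf (W.branches.cylinder (n + 1) w)) (sSup (W.branches.cylinder (n + 1) w)) :=
  (W.isOpen_cylinder _ w).eq_Ioo_csInf_csSup (W.ordConnected_cylinder _ w) h
    (W.bddBelow_cylinder w) (W.bddAbove_cylinder w)

theorem csInf_cylinder_mem {n : ℕ} {w : Fin (n + 1) → Fin (ℓ + 1)}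
    (h : (W.branches.cylinder (n + 1) w).Nonempty) :
    sInf (W.branches.cylinder (n + 1) w) ∈ Icc (W.cut (w 0).castSucc) (W.cut (w 0).succ) := by
  refine ⟨le_csInf h fun x hx => hx.1.1.le, ?_⟩
  obtain ⟨x, hx⟩ := h
  exact (csInf_le (W.bddBelow_cylinder w) hx).trans hx.1.2.le

theorem csSup_cylinder_mem {n : ℕ} {w : Fin (n + 1) → Fin (ℓ + 1)}
    (h : (W.branches.cylinder (n + 1) w).Nonempty) :
    sSup (W.branches.cylinder (n + 1) w) ∈ Icc (W.cut (w 0).castSucc) (W.cut (w 0).succ) := by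
  refine ⟨?_, csSup_le h fun x hx => hx.1.2.le⟩
  obtain ⟨x, hx⟩ := h
  exact hx.1.1.le.trans (le_csSup (W.bddAbove_cylinder w) hx)

theorem eq_of_mem_cylinder {n : ℕ} {w v : Fin n → Fin (ℓ + 1)} {x : ℝ}
    (hw : x ∈ W.branches.cylinder n w) (hv : x ∈ W.branches.cylinder n v) : w = v := by
  induction n generalizing x with
  | zero => exact Subsingleton.elim _ _
  | succ n ih =>
    have h0 : w 0 = v 0 := W.eq_of_mem_I_of_mem_Icc hw.1 (Ioo_subset_Icc_self hv.1)
    have ht : Fin.tail w = Fin.tail v := ih hw.2 (by rw [h0]; exact hv.2)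
    rw [← Fin.cons_self_tail w, ← Fin.cons_self_tail v, h0, ht]

theorem endCount_cylinder_eq_zero {n : ℕ} {w : Fin (n + 1) → Fin (ℓ + 1)} {i : Fin (ℓ + 1)}
    {J : Set ℝ} (hJ : J ⊆ W.I i) (h : w 0 ≠ i) :
    endCount J (W.branches.cylinder (n + 1) w) = 0 := by
  rw [endCount, if_neg, if_neg, add_zero]
  · rintro ⟨h1, h2⟩
    exact h (W.eq_of_mem_I_of_mem_Icc (hJ h2) (W.csSup_cylinder_mem h1)).symm
  · rintro ⟨h1, h2⟩
    exact h (W.eq_of_mem_I_of_mem_Icc (hJ h2) (W.csInf_cylinder_mem h1)).symm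

/-- The cylinders of level one are the `I_j`, whose ends are cutting points, and no cutting point
lies in `I_i`. -/
theorem lapCoeff_zero_eq_zero {i : Fin (ℓ + 1)} {J : Set ℝ} (hJ : J ⊆ W.I i) :
    W.branches.lapCoeff J 0 = 0 := by
  rw [BranchSystem.lapCoeff_eq_sum_endCount, Finset.sum_eq_zero, mul_zero]
  intro w _
  have hcyl : W.branches.cylinder 1 w = Ioo (W.cut (w 0).castSucc) (W.cut (w 0).succ) := by
    simp [BranchSystem.cylinder, branches, I]
  rw [hcyl, endCount, csInf_Ioo (W.cut_lt_cut_succ _), csSup_Ioo (W.cut_lt_cut_succ _), if_neg,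
    if_neg, add_zero, mul_zero]
  · exact fun h => W.cut_notMem_I _ _ (hJ h.2)
  · exact fun h => W.cut_notMem_I _ _ (hJ h.2)

/-- Only words beginning with `i` have end points in `J`. Such an end point is the preimage under
`f_i` of an end point of the tail cylinder, and the first letter contributes the factor `g_i`. -/
theorem lapCoeff_succ_eq {i : Fin (ℓ + 1)} {J : Set ℝ} (hJ : J ⊆ W.I i) (n : ℕ) :
    W.branches.lapCoeff J (n + 1) = W.g i * W.branches.lapCoeff (W.f i '' J) n := by
  have hsum : ∀ G : (Fin (n + 2) → Fin (ℓ + 1)) → ℝ, ∑ w, G w =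
      ∑ j, ∑ v, G ((Fin.consEquiv fun _ : Fin (n + 2) => Fin (ℓ + 1)) (j, v)) := fun G => by
    rw [← Equiv.sum_comp (Fin.consEquiv fun _ : Fin (n + 2) => Fin (ℓ + 1)) G]
    exact Fintype.sum_prod_type _
  rw [BranchSystem.lapCoeff_eq_sum_endCount, BranchSystem.lapCoeff_eq_sum_endCount, hsum,
    Finset.sum_eq_single i]
  · rw [mul_left_comm]
    congr 1
    rw [Finset.mul_sum]
    refine Finset.sum_congr rfl fun w _ => ?_
    have h1 : W.branches.cylinder (n + 2)
        ((Fin.consEquiv fun _ : Fin (n + 2) => Fin (ℓ + 1)) (i, w)) =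
        Ioo (W.cut i.castSucc) (W.cut i.succ) ∩ W.f i ⁻¹' W.branches.cylinder (n + 1) w := rfl
    have h2 : Fin.init ((Fin.consEquiv fun _ : Fin (n + 2) => Fin (ℓ + 1)) (i, w)) =
        Fin.cons i (Fin.init w) := by
      funext k
      exact Fin.cases rfl (fun k => rfl) k
    rw [h1, h2, endCount_preimage (W.f_continuousOn i) (W.f_strict i) hJ (W.isOpen_cylinder _ w)
      (W.ordConnected_cylinder _ w) (W.bddBelow_cylinder w) (W.bddAbove_cylinder w),
      BranchSystem.wordWeight_cons, mul_assoc]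
    rfl
  · intro j _ hj
    refine Finset.sum_eq_zero fun w _ => ?_
    rw [W.endCount_cylinder_eq_zero hJ, mul_zero]
    exact hj
  · simp

/-- By disjointness at most one cylinder of level `n + 1` has `x` as left end and at most one has it
as right end; the factor 1/2 averages the two weights. -/
theorem lapCoeff_singleton_le (x : ℝ) (n : ℕ) :
    W.branches.lapCoeff {x} n ≤ W.branches.normInf n := by
  classical
  have aux : ∀ P : (Fin (n + 1) → Fin (ℓ + 1)) → Prop,
      (∀ w, P w → (W.branches.cylinder (n + 1) w).Nonempty) →
      (∀ v w, P v → P w → v = w) →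
      ∑ w, W.branches.wordWeight (Fin.init w) * (if P w then 1 else 0) ≤
        W.branches.normInf n := by
    intro P hP huniq
    by_cases h : ∃ w, P w
    · obtain ⟨w, hw⟩ := h
      rw [Finset.sum_eq_single w]
      · rw [if_pos hw, mul_one]
        exact (le_abs_self _).trans (W.branches.abs_wordWeight_le_normInf
          (W.branches.init_mem_Z (W.branches.mem_Z.2 (hP w hw))))
      · intro v _ hv
        rw [if_neg fun h => hv (huniq _ _ h hw), mul_zero]
      · simp
    · push Not at h
      rw [Finset.sum_eq_zero fun w _ => by rw [if_neg (h w), mul_zero]]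
      exact W.branches.normInf_nonneg n
  have h1 := aux (fun w => (W.branches.cylinder (n + 1) w).Nonempty ∧
    sInf (W.branches.cylinder (n + 1) w) ∈ ({x} : Set ℝ)) (fun w hw => hw.1) (by
      rintro v w ⟨hv, hvx⟩ ⟨hw, hwx⟩
      have hv' := W.cylinder_eq_Ioo hv
      have hw' := W.cylinder_eq_Ioo hw
      rw [mem_singleton_iff.1 hvx] at hv'
      rw [mem_singleton_iff.1 hwx] at hw'
      rw [hv', nonempty_Ioo] at hv
      rw [hw', nonempty_Ioo] at hw
      obtain ⟨y, hy1, hy2⟩ := exists_between (lt_min hv hw)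
      refine W.eq_of_mem_cylinder (x := y) ?_ ?_
      · rw [hv']; exact ⟨hy1, hy2.trans_le (min_le_left _ _)⟩
      · rw [hw']; exact ⟨hy1, hy2.trans_le (min_le_right _ _)⟩)
  have h2 := aux (fun w => (W.branches.cylinder (n + 1) w).Nonempty ∧
    sSup (W.branches.cylinder (n + 1) w) ∈ ({x} : Set ℝ)) (fun w hw => hw.1) (by
      rintro v w ⟨hv, hvx⟩ ⟨hw, hwx⟩
      have hv' := W.cylinder_eq_Ioo hv
      have hw' := W.cylinder_eq_Ioo hw
      rw [mem_singleton_iff.1 hvx] at hv'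
      rw [mem_singleton_iff.1 hwx] at hw'
      rw [hv', nonempty_Ioo] at hv
      rw [hw', nonempty_Ioo] at hw
      obtain ⟨y, hy1, hy2⟩ := exists_between (max_lt hv hw)
      refine W.eq_of_mem_cylinder (x := y) ?_ ?_
      · rw [hv']; exact ⟨(le_max_left _ _).trans_lt hy1, hy2⟩
      · rw [hw']; exact ⟨(le_max_right _ _).trans_lt hy1, hy2⟩)
  rw [BranchSystem.lapCoeff_eq_sum_endCount]
  simp only [endCount, mul_add, Finset.sum_add_distrib]
  rw [← add_halves (W.branches.normInf n), ← mul_add, one_div_mul_eq_div, ← add_div]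
  gcongr ?_ / 2
  refine add_le_add (le_trans (le_of_eq ?_) h1) (le_trans (le_of_eq ?_) h2) <;>
  exact Finset.sum_congr rfl fun w _ => by congr

end WeightedSystem

/-! ### Extension of a branch to the closed interval -/

/-- Limits give only weak inequalities at the ends; strictness comes from two intermediate points `u
< v`. -/
theorem StrictMonoOn.Icc_of_Ioo {F : ℝ → ℝ} {c d : ℝ} (hm : StrictMonoOn F (Ioo c d))
    (hF : ContinuousOn F (Icc c d)) : StrictMonoOn F (Icc c d) := by
  intro x hx y hy hxy
  obtain ⟨u, hxu, huy⟩ := exists_between hxy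
  obtain ⟨v, huv, hvy⟩ := exists_between huy
  have hu : u ∈ Ioo c d := ⟨hx.1.trans_lt hxu, huy.trans_le hy.2⟩
  have hv : v ∈ Ioo c d := ⟨hu.1.trans huv, hvy.trans_le hy.2⟩
  have h1 : F x ≤ F u := by
    have ht : Tendsto F (𝓝[Ioo x u] x) (𝓝 (F x)) :=
      (hF x hx).mono fun z hz => ⟨hx.1.trans hz.1.le, hz.2.le.trans hu.2.le⟩
    rw [nhdsWithin_Ioo_eq_nhdsGT hxu] at ht
    refine le_of_tendsto ht ?_
    filter_upwards [Ioo_mem_nhdsGT hxu] with z hz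
    exact (hm ⟨hx.1.trans_lt hz.1, hz.2.trans hu.2⟩ hu hz.2).le
  have h2 : F v ≤ F y := by
    have ht : Tendsto F (𝓝[Ioo v y] y) (𝓝 (F y)) :=
      (hF y hy).mono fun z hz => ⟨hv.1.le.trans hz.1.le, hz.2.le.trans hy.2⟩
    rw [nhdsWithin_Ioo_eq_nhdsLT hvy] at ht
    refine ge_of_tendsto ht ?_
    filter_upwards [Ioo_mem_nhdsLT hvy] with z hz
    exact (hm hv ⟨hv.1.trans hz.1, hz.2.trans_le hy.2⟩ hz.1).le
  exact h1.trans_lt ((hm hu hv huv).trans_le h2)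

theorem StrictAntiOn.Icc_of_Ioo {F : ℝ → ℝ} {c d : ℝ} (hm : StrictAntiOn F (Ioo c d))
    (hF : ContinuousOn F (Icc c d)) : StrictAntiOn F (Icc c d) := fun _ hx _ hy hxy =>
  neg_lt_neg_iff.1 (StrictMonoOn.Icc_of_Ioo (F := fun x => -F x) hm.neg hF.neg hx hy hxy)

/-! ### One-sided germs -/

/-- `(x, true)` is the germ `x⁺` and `(x, false)` is the germ `x⁻`; this says that the germ lies
in `]c, d[`. -/
def IsGerm (c d : ℝ) : ℝ × Bool → Prop
  | (x, true) => x ∈ Ico c d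
  | (x, false) => x ∈ Ioc c d

/-- The filter of one-sided neighbourhoods of a germ. -/
def germNhds : ℝ × Bool → Filter ℝ
  | (x, true) => 𝓝[>] x
  | (x, false) => 𝓝[<] x

/-- The interval of the points above `a` that lie below a germ. -/
def belowGerm (a : ℝ) : ℝ × Bool → Set ℝ
  | (x, true) => Ioc a x
  | (x, false) => Ioo a x

theorem germNhds_neBot (p : ℝ × Bool) : (germNhds p).NeBot := by
  rcases p with ⟨x, _ | _⟩ <;> (dsimp only [germNhds]; infer_instance)

theorem Ioo_mem_germNhds {c d : ℝ} {p : ℝ × Bool} (hp : IsGerm c d p) : Ioo c d ∈ germNhds p := by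
  rcases p with ⟨x, _ | _⟩
  · exact mem_of_superset (Ioo_mem_nhdsLT hp.1) (Ioo_subset_Ioo le_rfl hp.2)
  · exact mem_of_superset (Ioo_mem_nhdsGT hp.2) (Ioo_subset_Ioo hp.1 le_rfl)

theorem IsGerm.mem_Icc {c d : ℝ} {p : ℝ × Bool} (hp : IsGerm c d p) : p.1 ∈ Icc c d := by
  rcases p with ⟨x, _ | _⟩
  · exact Ioc_subset_Icc_self hp
  · exact Ico_subset_Icc_self hp

namespace WeightedSystem

variable {a b : ℝ} {ℓ : ℕ} (W : WeightedSystem a b ℓ)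

/-- The continuous extension of `f_i` to `[c_i, c_{i+1}]`. -/
noncomputable def fExt (i : Fin (ℓ + 1)) : ℝ → ℝ := extendFrom (W.I i) (W.f i)

theorem fExt_continuousOn (i : Fin (ℓ + 1)) :
    ContinuousOn (W.fExt i) (Icc (W.cut i.castSucc) (W.cut i.succ)) := by
  have hne := nonempty_Ioo.2 (W.cut_lt_cut_succ i)
  have hba : BddAbove (W.f i '' Ioo (W.cut i.castSucc) (W.cut i.succ)) :=
    bddAbove_Icc.mono (W.f_mapsTo i).image_subset
  have hbb : BddBelow (W.f i '' Ioo (W.cut i.castSucc) (W.cut i.succ)) :=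
    bddBelow_Icc.mono (W.f_mapsTo i).image_subset
  rcases W.f_strict i with h | h
  · exact continuousOn_Icc_extendFrom_Ioo (W.f_continuousOn i)
      (h.monotoneOn.tendsto_nhdsWithin_Ioo_right hne hbb)
      (h.monotoneOn.tendsto_nhdsWithin_Ioo_left hne hba)
  · exact continuousOn_Icc_extendFrom_Ioo (W.f_continuousOn i)
      (h.antitoneOn.tendsto_nhdsWithin_Ioo_right hne hba)
      (h.antitoneOn.tendsto_nhdsWithin_Ioo_left hne hbb)

theorem fExt_eqOn (i : Fin (ℓ + 1)) : EqOn (W.fExt i) (W.f i) (W.I i) := fun x hx =>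
  extendFrom_eq (subset_closure hx) ((W.f_continuousOn i) x hx)

theorem fExt_mapsTo (i : Fin (ℓ + 1)) :
    MapsTo (W.fExt i) (Icc (W.cut i.castSucc) (W.cut i.succ)) (Icc a b) := by
  have h1 : MapsTo (W.fExt i) (W.I i) (Icc a b) := fun x hx => by
    rw [W.fExt_eqOn i hx]; exact W.f_mapsTo i hx
  have h2 : closure (W.I i) = Icc (W.cut i.castSucc) (W.cut i.succ) :=
    closure_Ioo (W.cut_lt_cut_succ i).ne
  have h3 := h1.closure_of_continuousOn (h2 ▸ W.fExt_continuousOn i)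
  rwa [h2, isClosed_Icc.closure_eq] at h3

theorem fExt_strictMonoOn {i : Fin (ℓ + 1)} (h : StrictMonoOn (W.f i) (W.I i)) :
    StrictMonoOn (W.fExt i) (Icc (W.cut i.castSucc) (W.cut i.succ)) :=
  (h.congr (W.fExt_eqOn i).symm).Icc_of_Ioo (W.fExt_continuousOn i)

theorem fExt_strictAntiOn {i : Fin (ℓ + 1)} (h : ¬ StrictMonoOn (W.f i) (W.I i)) :
    StrictAntiOn (W.fExt i) (Icc (W.cut i.castSucc) (W.cut i.succ)) :=
  (((W.f_strict i).resolve_left h).congr (W.fExt_eqOn i).symm).Icc_of_Ioo (W.fExt_continuousOn i)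

theorem abs_s (i : Fin (ℓ + 1)) : |W.s i| = 1 := by
  rw [s]
  split_ifs <;> simp

theorem s_mul_s (i : Fin (ℓ + 1)) : W.s i * W.s i = 1 := by
  rw [s]
  split_ifs <;> simp

open Classical in
/-- The image of a germ under the branch `i`. -/
noncomputable def germMap (i : Fin (ℓ + 1)) (p : ℝ × Bool) : ℝ × Bool :=
  (W.fExt i p.1, if StrictMonoOn (W.f i) (W.I i) then p.2 else !p.2)

/-- Strict monotonicity up to the ends keeps the image away from that end of `[a, b]` at which the
image germ would point outwards. -/
theorem isGerm_germMap {i : Fin (ℓ + 1)} {p : ℝ × Bool}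
    (hp : IsGerm (W.cut i.castSucc) (W.cut i.succ) p) : IsGerm a b (W.germMap i p) := by
  have hl := left_mem_Icc.2 (W.cut_lt_cut_succ i).le
  have hr := right_mem_Icc.2 (W.cut_lt_cut_succ i).le
  have hpm := hp.mem_Icc
  have hm := W.fExt_mapsTo i hpm
  have hml := W.fExt_mapsTo i hl
  have hmr := W.fExt_mapsTo i hr
  by_cases h : StrictMonoOn (W.f i) (W.I i)
  · have hs := W.fExt_strictMonoOn h
    rcases p with ⟨x, _ | _⟩ <;> simp only [germMap, h, if_true, IsGerm]
    · exact ⟨hml.1.trans_lt (hs hl hpm hp.1), hm.2⟩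
    · exact ⟨hm.1, (hs hpm hr hp.2).trans_le hmr.2⟩
  · have hs := W.fExt_strictAntiOn h
    rcases p with ⟨x, _ | _⟩ <;> simp only [germMap, h, if_false, IsGerm, Bool.not_false,
      Bool.not_true]
    · exact ⟨hm.1, (hs hl hpm hp.1).trans_le hml.2⟩
    · exact ⟨hmr.1.trans_lt (hs hpm hr hp.2), hm.2⟩

theorem I_mem_germNhds {i : Fin (ℓ + 1)} {p : ℝ × Bool}
    (hp : IsGerm (W.cut i.castSucc) (W.cut i.succ) p) : W.I i ∈ germNhds p := Ioo_mem_germNhds hp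

theorem tendsto_germMap {i : Fin (ℓ + 1)} {p : ℝ × Bool}
    (hp : IsGerm (W.cut i.castSucc) (W.cut i.succ) p) :
    Tendsto (W.f i) (germNhds p) (germNhds (W.germMap i p)) := by
  have hI := W.I_mem_germNhds hp
  refine Tendsto.congr' (f₁ := W.fExt i) (by
    filter_upwards [hI] with x hx using W.fExt_eqOn i hx) ?_
  have hpm := hp.mem_Icc
  have hcont : Tendsto (W.fExt i) (germNhds p) (𝓝 (W.fExt i p.1)) := by
    refine (W.fExt_continuousOn i p.1 hpm).mono_left (le_inf ?_ ?_)
    · rcases p with ⟨x, _ | _⟩ <;> exact nhdsWithin_le_nhds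
    · exact le_principal_iff.2 (mem_of_superset hI Ioo_subset_Icc_self)
  by_cases h : StrictMonoOn (W.f i) (W.I i)
  · have hs := W.fExt_strictMonoOn h
    rcases p with ⟨x, _ | _⟩ <;> simp only [germMap, h, if_true, germNhds] <;>
      refine tendsto_nhdsWithin_iff.2 ⟨hcont, ?_⟩ <;>
      filter_upwards [hI, self_mem_nhdsWithin] with y hy hxy
    · exact hs (Ioo_subset_Icc_self hy) hpm hxy
    · exact hs hpm (Ioo_subset_Icc_self hy) hxy
  · have hs := W.fExt_strictAntiOn h
    rcases p with ⟨x, _ | _⟩ <;> simp only [germMap, h, if_false, germNhds, Bool.not_false,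
      Bool.not_true] <;>
      refine tendsto_nhdsWithin_iff.2 ⟨hcont, ?_⟩ <;>
      filter_upwards [hI, self_mem_nhdsWithin] with y hy hxy
    · exact hs (Ioo_subset_Icc_self hy) hpm hxy
    · exact hs hpm (Ioo_subset_Icc_self hy) hxy

/-- The weighted lap function of the points below a germ, as a formal power series. -/
noncomputable def lapSeries (p : ℝ × Bool) : PowerSeries ℝ :=
  PowerSeries.mk (W.branches.lapCoeff (belowGerm a p))

theorem belowGerm_cut_subset {i : Fin (ℓ + 1)} {p : ℝ × Bool}
    (hp : IsGerm (W.cut i.castSucc) (W.cut i.succ) p) :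
    belowGerm a (W.cut i.castSucc, true) ⊆ belowGerm a p := by
  rcases p with ⟨x, _ | _⟩
  · exact fun y hy => ⟨hy.1, hy.2.trans_lt hp.1⟩
  · exact fun y hy => ⟨hy.1, hy.2.trans hp.1⟩

theorem belowGerm_diff_cut {i : Fin (ℓ + 1)} {p : ℝ × Bool}
    (hp : IsGerm (W.cut i.castSucc) (W.cut i.succ) p) :
    belowGerm a p \ belowGerm a (W.cut i.castSucc, true) = belowGerm (W.cut i.castSucc) p := by
  have ha := W.le_cut i.castSucc
  rcases p with ⟨x, _ | _⟩ <;> ext y <;>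
    simp only [belowGerm, Set.mem_sdiff, mem_Ioo, mem_Ioc, not_and, not_le]
  · exact ⟨fun h => ⟨h.2 h.1.1, h.1.2⟩, fun h => ⟨⟨ha.trans_lt h.1, h.2⟩, fun _ => h.1⟩⟩
  · exact ⟨fun h => ⟨h.2 h.1.1, h.1.2⟩, fun h => ⟨⟨ha.trans_lt h.1, h.2⟩, fun _ => h.1⟩⟩

theorem belowGerm_subset_I {i : Fin (ℓ + 1)} {p : ℝ × Bool}
    (hp : IsGerm (W.cut i.castSucc) (W.cut i.succ) p) :
    belowGerm (W.cut i.castSucc) p ⊆ W.I i := by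
  rcases p with ⟨x, _ | _⟩
  · exact fun y hy => ⟨hy.1, hy.2.trans_le hp.2⟩
  · exact fun y hy => ⟨hy.1, hy.2.trans_lt hp.2⟩

theorem lapCoeff_germ_sub_zero {i : Fin (ℓ + 1)} {p : ℝ × Bool}
    (hp : IsGerm (W.cut i.castSucc) (W.cut i.succ) p) :
    W.branches.lapCoeff (belowGerm a p) 0 -
      W.branches.lapCoeff (belowGerm a (W.cut i.castSucc, true)) 0 = 0 := by
  rw [← BranchSystem.lapCoeff_diff _ (W.belowGerm_cut_subset hp), W.belowGerm_diff_cut hp]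
  exact W.lapCoeff_zero_eq_zero (W.belowGerm_subset_I hp)

/-- The points between `c_i⁺` and `p` lie in `I_i`, and by the intermediate value theorem their
image is exactly the set between the two image germs; keeping track of germs settles which ends
belong to it. A decreasing branch reverses the order of the image germs, which is the origin of the
sign `s_i`. -/
theorem lapCoeff_germ_sub_succ {i : Fin (ℓ + 1)} {p : ℝ × Bool}
    (hp : IsGerm (W.cut i.castSucc) (W.cut i.succ) p) (n : ℕ) :
    W.branches.lapCoeff (belowGerm a p) (n + 1) -
      W.branches.lapCoeff (belowGerm a (W.cut i.castSucc, true)) (n + 1) =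
    W.s i * W.g i * (W.branches.lapCoeff (belowGerm a (W.germMap i p)) n -
      W.branches.lapCoeff (belowGerm a (W.germMap i (W.cut i.castSucc, true))) n) := by
  rw [← BranchSystem.lapCoeff_diff _ (W.belowGerm_cut_subset hp), W.belowGerm_diff_cut hp,
    W.lapCoeff_succ_eq (W.belowGerm_subset_I hp)]
  set c := W.cut i.castSucc with hc
  have hl : c ∈ Icc c (W.cut i.succ) := left_mem_Icc.2 (W.cut_lt_cut_succ i).le
  have hpm := hp.mem_Icc
  have hcont : ContinuousOn (W.fExt i) (Icc c p.1) :=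
    (W.fExt_continuousOn i).mono (Icc_subset_Icc le_rfl hpm.2)
  have hsub : Icc c p.1 ⊆ Icc c (W.cut i.succ) := Icc_subset_Icc le_rfl hpm.2
  have haF := (W.fExt_mapsTo i hl).1
  have haX := (W.fExt_mapsTo i hpm).1
  rw [← ((W.fExt_eqOn i).mono (W.belowGerm_subset_I hp)).image_eq]
  by_cases h : StrictMonoOn (W.f i) (W.I i)
  · have hs := W.fExt_strictMonoOn h
    have himg : W.fExt i '' belowGerm c p =
        belowGerm a (W.germMap i p) \ belowGerm a (W.germMap i (c, true)) := by
      rcases p with ⟨x, _ | _⟩ <;> simp only [germMap, h, if_true, belowGerm]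
      · have h1 : Ioo a (W.fExt i x) \ Ioc a (W.fExt i c) = Ioo (W.fExt i c) (W.fExt i x) := by
          ext y
          simp only [Set.mem_sdiff, mem_Ioo, mem_Ioc, not_and, not_le]
          exact ⟨fun h => ⟨h.2 h.1.1, h.1.2⟩, fun h => ⟨⟨haF.trans_lt h.1, h.2⟩, fun _ => h.1⟩⟩
        rw [h1]
        refine Subset.antisymm ?_ (intermediate_value_Ioo hpm.1 hcont)
        rintro _ ⟨y, hy, rfl⟩
        have hy' := hsub (Ioo_subset_Icc_self hy)
        exact ⟨hs hl hy' hy.1, hs hy' hpm hy.2⟩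
      · have h1 : Ioc a (W.fExt i x) \ Ioc a (W.fExt i c) = Ioc (W.fExt i c) (W.fExt i x) := by
          ext y
          simp only [Set.mem_sdiff, mem_Ioc, not_and, not_le]
          exact ⟨fun h => ⟨h.2 h.1.1, h.1.2⟩, fun h => ⟨⟨haF.trans_lt h.1, h.2⟩, fun _ => h.1⟩⟩
        rw [h1]
        refine Subset.antisymm ?_ (intermediate_value_Ioc hpm.1 hcont)
        rintro _ ⟨y, hy, rfl⟩
        have hy' := hsub (Ioc_subset_Icc_self hy)
        exact ⟨hs hl hy' hy.1, hs.monotoneOn hy' hpm hy.2⟩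
    have hle : belowGerm a (W.germMap i (c, true)) ⊆ belowGerm a (W.germMap i p) := by
      rcases p with ⟨x, _ | _⟩ <;> simp only [germMap, h, if_true, belowGerm]
      · exact fun y hy => ⟨hy.1, hy.2.trans_lt (hs hl hpm hp.1)⟩
      · exact fun y hy => ⟨hy.1, hy.2.trans (hs.monotoneOn hl hpm hp.1)⟩
    rw [himg, BranchSystem.lapCoeff_diff _ hle]
    simp [s, h]
  · have hs := W.fExt_strictAntiOn h
    have himg : W.fExt i '' belowGerm c p =
        belowGerm a (W.germMap i (c, true)) \ belowGerm a (W.germMap i p) := by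
      rcases p with ⟨x, _ | _⟩ <;> simp only [germMap, h, if_false, belowGerm, Bool.not_true,
        Bool.not_false]
      · have h1 : Ioo a (W.fExt i c) \ Ioc a (W.fExt i x) = Ioo (W.fExt i x) (W.fExt i c) := by
          ext y
          simp only [Set.mem_sdiff, mem_Ioo, mem_Ioc, not_and, not_le]
          exact ⟨fun h => ⟨h.2 h.1.1, h.1.2⟩, fun h => ⟨⟨haX.trans_lt h.1, h.2⟩, fun _ => h.1⟩⟩
        rw [h1]
        refine Subset.antisymm ?_ (intermediate_value_Ioo' hpm.1 hcont)
        rintro _ ⟨y, hy, rfl⟩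
        have hy' := hsub (Ioo_subset_Icc_self hy)
        exact ⟨hs hy' hpm hy.2, hs hl hy' hy.1⟩
      -- Here the image contains its lower end `W.fExt i x`, so the value `a` must be excluded; this
      -- is what being a germ `x⁺` mapped to a left germ provides, with `p` itself reversed
      -- accordingly.
      · have haX' : a < W.fExt i x := by
          have h' := W.isGerm_germMap hp
          simp only [germMap, h, if_false, IsGerm, Bool.not_true] at h'
          exact h'.1
        have h1 : Ioo a (W.fExt i c) \ Ioo a (W.fExt i x) = Ico (W.fExt i x) (W.fExt i c) := by
          ext y
          simp only [Set.mem_sdiff, mem_Ioo, mem_Ico, not_and, not_lt]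
          exact ⟨fun h => ⟨h.2 h.1.1, h.1.2⟩, fun h => ⟨⟨haX'.trans_le h.1, h.2⟩, fun _ => h.1⟩⟩
        rw [h1]
        refine Subset.antisymm ?_ (intermediate_value_Ioc' hpm.1 hcont)
        rintro _ ⟨y, hy, rfl⟩
        have hy' := hsub (Ioc_subset_Icc_self hy)
        exact ⟨hs.antitoneOn hy' hpm hy.2, hs hl hy' hy.1⟩
    have hle : belowGerm a (W.germMap i p) ⊆ belowGerm a (W.germMap i (c, true)) := by
      rcases p with ⟨x, _ | _⟩ <;> simp only [germMap, h, if_false, belowGerm, Bool.not_true,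
        Bool.not_false]
      · exact fun y hy => ⟨hy.1, hy.2.trans_lt (hs hl hpm hp.1)⟩
      · exact fun y hy => ⟨hy.1, hy.2.trans_le (hs.antitoneOn hl hpm hp.1)⟩
    rw [himg, BranchSystem.lapCoeff_diff _ hle, s, if_neg h]
    ring

theorem isGerm_cut (i : Fin (ℓ + 1)) :
    IsGerm (W.cut i.castSucc) (W.cut i.succ) (W.cut i.castSucc, true) :=
  ⟨le_rfl, W.cut_lt_cut_succ i⟩

open PowerSeries in
theorem lapSeries_sub {i : Fin (ℓ + 1)} {p q : ℝ × Bool}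
    (hp : IsGerm (W.cut i.castSucc) (W.cut i.succ) p)
    (hq : IsGerm (W.cut i.castSucc) (W.cut i.succ) q) :
    W.lapSeries p - W.lapSeries q =
      C (W.s i * W.g i) * X * (W.lapSeries (W.germMap i p) - W.lapSeries (W.germMap i q)) := by
  ext n
  rw [mul_assoc, coeff_C_mul, map_sub]
  rcases n with _ | n
  · simp only [coeff_zero_X_mul, mul_zero, lapSeries, coeff_mk]
    linarith [W.lapCoeff_germ_sub_zero hp, W.lapCoeff_germ_sub_zero hq]
  · simp only [coeff_succ_X_mul, lapSeries, coeff_mk, map_sub]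
    linarith [W.lapCoeff_germ_sub_succ hp n, W.lapCoeff_germ_sub_succ hq n]

end WeightedSystem

/-! ### The kneading matrix -/

namespace WeightedSystem

variable {a b : ℝ} {ℓ : ℕ} (W : WeightedSystem a b ℓ)

theorem exists_isGerm {p : ℝ × Bool} (hp : IsGerm a b p) :
    ∃ i : Fin (ℓ + 1), IsGerm (W.cut i.castSucc) (W.cut i.succ) p := by
  rcases p with ⟨x, _ | _⟩
  · exact W.exists_mem_Ioc hp
  · exact W.exists_mem_Ico hp

theorem isGerm_unique {p : ℝ × Bool} {i j : Fin (ℓ + 1)}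
    (hi : IsGerm (W.cut i.castSucc) (W.cut i.succ) p)
    (hj : IsGerm (W.cut j.castSucc) (W.cut j.succ) p) : i = j := by
  have := germNhds_neBot p
  obtain ⟨x, hx⟩ := Filter.nonempty_of_mem (inter_mem (W.I_mem_germNhds hi) (W.I_mem_germNhds hj))
  exact W.eq_of_mem_I_of_mem_Icc hx.1 (Ioo_subset_Icc_self hx.2)

open Classical in
/-- The index of the branch whose domain contains a germ. -/
noncomputable def germIdx (p : ℝ × Bool) : Fin (ℓ + 1) :=
  if h : ∃ i : Fin (ℓ + 1), IsGerm (W.cut i.castSucc) (W.cut i.succ) p then h.choose else 0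

theorem isGerm_germIdx {p : ℝ × Bool} (hp : IsGerm a b p) :
    IsGerm (W.cut (W.germIdx p).castSucc) (W.cut (W.germIdx p).succ) p := by
  have h := W.exists_isGerm hp
  rw [germIdx, dif_pos h]
  exact h.choose_spec

theorem germIdx_eq {p : ℝ × Bool} (hp : IsGerm a b p) {i : Fin (ℓ + 1)}
    (hi : IsGerm (W.cut i.castSucc) (W.cut i.succ) p) : W.germIdx p = i :=
  W.isGerm_unique (W.isGerm_germIdx hp) hi

theorem isGerm_cut_global (i : Fin (ℓ + 1)) : IsGerm a b (W.cut i.castSucc, true) :=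
  ⟨W.le_cut _, (W.cut_lt_cut_succ i).trans_le (W.cut_le _)⟩

/-- The image of a germ. -/
noncomputable def germNext (p : ℝ × Bool) : ℝ × Bool := W.germMap (W.germIdx p) p

theorem isGerm_germNext {p : ℝ × Bool} (hp : IsGerm a b p) : IsGerm a b (W.germNext p) :=
  W.isGerm_germMap (W.isGerm_germIdx hp)

/-- The first `n` letters of the itinerary of a germ. -/
noncomputable def germWord : (n : ℕ) → ℝ × Bool → (Fin n → Fin (ℓ + 1))
  | 0, _ => Fin.elim0
  | n + 1, p => Fin.cons (W.germIdx p) (germWord n (W.germNext p))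

/-- The cylinder of an itinerary is a one-sided neighbourhood of its germ, hence non-empty.
Itineraries are therefore admissible, and kneading coefficients are bounded by `normInf`. -/
theorem cylinder_germWord_mem {p : ℝ × Bool} (hp : IsGerm a b p) (n : ℕ) :
    W.branches.cylinder n (W.germWord n p) ∈ germNhds p := by
  induction n generalizing p with
  | zero => exact univ_mem
  | succ n ih =>
    have hi := W.isGerm_germIdx hp
    exact inter_mem (W.I_mem_germNhds hi) (W.tendsto_germMap hi (ih (W.isGerm_germNext hp)))

theorem abs_wordWeight_germWord_le {p : ℝ × Bool} (hp : IsGerm a b p) (n : ℕ) :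
    |W.branches.wordWeight (W.germWord n p)| ≤ W.branches.normInf n := by
  have := germNhds_neBot p
  exact W.branches.abs_wordWeight_le_normInf
    (W.branches.mem_Z.2 (nonempty_of_mem (W.cylinder_germWord_mem hp n)))

/-- The signed weight of the `n`-th image of a germ if that image lies in `I_j`, and zero
otherwise. -/
noncomputable def kneadCoeff (j : Fin (ℓ + 1)) : ℕ → ℝ × Bool → ℝ
  | 0, p => if W.germIdx p = j then 1 else 0
  | n + 1, p => W.s (W.germIdx p) * W.g (W.germIdx p) * kneadCoeff j n (W.germNext p)

theorem abs_kneadCoeff_le (j : Fin (ℓ + 1)) (n : ℕ) (p : ℝ × Bool) :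
    |W.kneadCoeff j n p| ≤ |W.branches.wordWeight (W.germWord n p)| := by
  induction n generalizing p with
  | zero =>
    simp only [kneadCoeff, BranchSystem.wordWeight, Finset.univ_eq_empty, Finset.prod_empty]
    split_ifs <;> simp
  | succ n ih =>
    rw [kneadCoeff, germWord, BranchSystem.wordWeight_cons, abs_mul, abs_mul, abs_mul, W.abs_s,
      one_mul]
    exact mul_le_mul_of_nonneg_left (ih _) (abs_nonneg _)

/-- The kneading series of a germ. -/
noncomputable def kneadSeries (j : Fin (ℓ + 1)) (p : ℝ × Bool) : PowerSeries ℝ :=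
  PowerSeries.mk fun n => W.kneadCoeff j n p

open PowerSeries in
theorem kneadSeries_eq (j : Fin (ℓ + 1)) (p : ℝ × Bool) :
    W.kneadSeries j p = (if W.germIdx p = j then 1 else 0) +
      C (W.s (W.germIdx p) * W.g (W.germIdx p)) * X * W.kneadSeries j (W.germNext p) := by
  ext n
  rw [mul_assoc, map_add, coeff_C_mul]
  rcases n with _ | n
  · simp only [kneadSeries, coeff_mk, kneadCoeff, coeff_zero_X_mul, mul_zero, add_zero]
    split_ifs <;> simp
  · simp only [kneadSeries, coeff_mk, kneadCoeff, coeff_succ_X_mul]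
    split_ifs <;> simp [coeff_one]

open PowerSeries in
/-- The part of the lap series of a germ in `I_i` that does not depend on the germ. -/
noncomputable def baseSeries (i : Fin (ℓ + 1)) : PowerSeries ℝ :=
  W.lapSeries (W.cut i.castSucc, true) -
    C (W.s i * W.g i) * X * W.lapSeries (W.germMap i (W.cut i.castSucc, true))

open PowerSeries in
theorem lapSeries_eq_base_add {p : ℝ × Bool} (hp : IsGerm a b p) :
    W.lapSeries p = W.baseSeries (W.germIdx p) +
      C (W.s (W.germIdx p) * W.g (W.germIdx p)) * X * W.lapSeries (W.germNext p) := by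
  have := W.lapSeries_sub (W.isGerm_germIdx hp) (W.isGerm_cut (W.germIdx p))
  rw [baseSeries, germNext]
  linear_combination this

open PowerSeries in
-- Both sides obey the same recursion along the orbit of the germ. Each step multiplies their
-- difference by `X`, so all its coefficients vanish.
theorem lapSeries_eq_sum {p : ℝ × Bool} (hp : IsGerm a b p) :
    W.lapSeries p = ∑ j, W.kneadSeries j p * W.baseSeries j := by
  have key : ∀ q, IsGerm a b q → W.lapSeries q - ∑ j, W.kneadSeries j q * W.baseSeries j =
      C (W.s (W.germIdx q) * W.g (W.germIdx q)) * (X * (W.lapSeries (W.germNext q) -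
        ∑ j, W.kneadSeries j (W.germNext q) * W.baseSeries j)) := by
    intro q hq
    have h1 : ∑ j, W.kneadSeries j q * W.baseSeries j = W.baseSeries (W.germIdx q) +
        C (W.s (W.germIdx q) * W.g (W.germIdx q)) * X *
          ∑ j, W.kneadSeries j (W.germNext q) * W.baseSeries j := by
      rw [Finset.sum_congr rfl fun j _ => by rw [W.kneadSeries_eq j q, add_mul, mul_assoc],
        Finset.sum_add_distrib, ← Finset.mul_sum]
      congr 1
      simp
    rw [h1, W.lapSeries_eq_base_add hq]
    ring
  rw [← sub_eq_zero]
  ext n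
  rw [map_zero]
  induction n generalizing p with
  | zero => rw [key p hp, coeff_C_mul, coeff_zero_X_mul, mul_zero]
  | succ n ih => rw [key p hp, coeff_C_mul, coeff_succ_X_mul, ih (W.isGerm_germNext hp), mul_zero]

/-- The kneading matrix. -/
noncomputable def kneadMatrix : Matrix (Fin (ℓ + 1)) (Fin (ℓ + 1)) (PowerSeries ℝ) := fun i j =>
  W.kneadSeries j (W.cut i.castSucc, true) -
    if i = 0 then 0 else W.kneadSeries j (W.cut i.castSucc, false)

/-- The lap series of the cutting points. -/
noncomputable def cutSeries (i : Fin (ℓ + 1)) : PowerSeries ℝ :=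
  if i = 0 then 0 else PowerSeries.mk (W.branches.lapCoeff {W.cut i.castSucc})

theorem left_lt_cut {i : Fin (ℓ + 1)} (hi : i ≠ 0) : a < W.cut i.castSucc := by
  have := W.cut_strictMono (show (0 : Fin (ℓ + 2)) < i.castSucc from
    Fin.castSucc_pos_iff.2 (Fin.pos_iff_ne_zero.2 hi))
  rwa [W.cut_zero] at this

theorem isGerm_cut_left {i : Fin (ℓ + 1)} (hi : i ≠ 0) : IsGerm a b (W.cut i.castSucc, false) :=
  ⟨W.left_lt_cut hi, W.cut_le _⟩

theorem lapCoeff_belowGerm_sub {x : ℝ} (hx : a < x) (n : ℕ) :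
    W.branches.lapCoeff (belowGerm a (x, true)) n -
      W.branches.lapCoeff (belowGerm a (x, false)) n = W.branches.lapCoeff {x} n := by
  rw [← BranchSystem.lapCoeff_diff]
  · congr 1
    ext y
    simp only [belowGerm, Set.mem_sdiff, mem_Ioo, mem_Ioc, mem_singleton_iff, not_and, not_lt]
    exact ⟨fun h => le_antisymm h.1.2 (h.2 h.1.1), fun h => by subst h; exact
      ⟨⟨hx, le_rfl⟩, fun _ => le_rfl⟩⟩
  · exact Ioo_subset_Ioc_self

theorem lapSeries_left : W.lapSeries (a, true) = 0 := by
  ext n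
  simp [lapSeries, belowGerm, BranchSystem.lapCoeff]

/-- Row `i` expresses the jump of the lap series from `c_i⁻` to `c_i⁺`, which is the contribution of
the point `c_i`. Row 0 uses `a⁺` alone, below which there are no points. -/
theorem kneadMatrix_mulVec : W.kneadMatrix.mulVec W.baseSeries = W.cutSeries := by
  funext i
  simp only [Matrix.mulVec, dotProduct, kneadMatrix, cutSeries]
  by_cases hi : i = 0
  · subst hi
    simp only [if_true, sub_zero]
    rw [← W.lapSeries_eq_sum (W.isGerm_cut_global 0), Fin.castSucc_zero, W.cut_zero,
      W.lapSeries_left]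
  · simp only [if_neg hi, sub_mul, Finset.sum_sub_distrib]
    rw [← W.lapSeries_eq_sum (W.isGerm_cut_global i), ← W.lapSeries_eq_sum (W.isGerm_cut_left hi)]
    ext n
    simpa [lapSeries] using W.lapCoeff_belowGerm_sub (W.left_lt_cut hi) n

/-- At `t = 0` a kneading series records only the first letter. This letter is `i` for `c_i⁺` and
smaller than `i` for `c_i⁻`, so the matrix is lower triangular with ones on the diagonal. -/
theorem constantCoeff_det_kneadMatrix : PowerSeries.constantCoeff W.kneadMatrix.det = 1 := by
  have hconst : ∀ j p, PowerSeries.constantCoeff (W.kneadSeries j p) =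
      if W.germIdx p = j then 1 else 0 := fun j p => by
    rw [← PowerSeries.coeff_zero_eq_constantCoeff_apply, kneadSeries, PowerSeries.coeff_mk,
      kneadCoeff]
  have hentry : ∀ i j, PowerSeries.constantCoeff (W.kneadMatrix i j) =
      (if i = j then 1 else 0) -
        if i = 0 then 0 else if W.germIdx (W.cut i.castSucc, false) = j then 1 else 0 := by
    intro i j
    have h := W.germIdx_eq (W.isGerm_cut_global i) (W.isGerm_cut i)
    rw [kneadMatrix, map_sub, hconst, h, apply_ite PowerSeries.constantCoeff, hconst, map_zero]
  have hlt : ∀ i : Fin (ℓ + 1), i ≠ 0 → W.germIdx (W.cut i.castSucc, false) < i := by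
    intro i hi
    have h := (W.isGerm_germIdx (W.isGerm_cut_left hi)).1
    rw [W.cut_strictMono.lt_iff_lt] at h
    exact h
  rw [RingHom.map_det, Matrix.det_of_isLowerTriangular]
  · refine Finset.prod_eq_one fun i _ => ?_
    rw [RingHom.mapMatrix_apply, Matrix.map_apply, hentry]
    by_cases hi : i = 0
    · simp [hi]
    · simp [hi, (hlt i hi).ne]
  · intro i j hij
    have hij' : i < j := hij
    rw [RingHom.mapMatrix_apply, Matrix.map_apply, hentry, if_neg hij'.ne]
    by_cases hi : i = 0
    · simp [hi]
    · simp [hi, ((hlt i hi).trans hij').ne]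

/-- The spectral gap enters here: a rate `r` strictly between `ρ_∞` and `ρ₁` leaves room for a
radius between `1/ρ₁` and `1/r`. -/
theorem exists_summable_normInf (hρ : W.branches.rhoInf < W.branches.rhoOne) :
    ∃ R, 1 / W.branches.rhoOne < R ∧ Summable fun n => W.branches.normInf n * R ^ n := by
  obtain ⟨r, hr1, hr2⟩ := exists_between hρ
  have hr : 0 < r := W.branches.rhoInf_nonneg.trans_lt hr1
  obtain ⟨R, hR1, hR2⟩ := exists_between (one_div_lt_one_div_of_lt hr hr2)
  have hR : 0 < R := (one_div_pos.2 (hr.trans hr2)).trans hR1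
  refine ⟨R, hR1, ?_⟩
  have hrR : r * R < 1 := by rwa [lt_div_iff₀ hr, mul_comm] at hR2
  refine Summable.of_norm_bounded_eventually_nat
    (summable_geometric_of_lt_one (by positivity) hrR) ?_
  filter_upwards [W.branches.eventually_normInf_le_pow hr1] with n hn
  rw [norm_mul, norm_pow, Real.norm_of_nonneg hR.le,
    Real.norm_of_nonneg (W.branches.normInf_nonneg n), mul_pow]
  gcongr

theorem mem_convergentSubring_of_abs_le {R : ℝ} (hR : 0 ≤ R)
    (hs : Summable fun n => W.branches.normInf n * R ^ n) {u : ℕ → ℝ}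
    (h : ∀ n, |u n| ≤ W.branches.normInf n) :
    PowerSeries.mk u ∈ PowerSeries.convergentSubring R := by
  refine Summable.of_nonneg_of_le (fun _ => norm_nonneg _) (fun n => ?_) hs
  rw [PowerSeries.coeff_mk, norm_mul, norm_pow, Real.norm_of_nonneg hR, Real.norm_eq_abs]
  gcongr
  exact h n

/-- The kneading determinant times a lap series converges beyond `1/ρ₁`. -/
theorem det_mul_lapSeries_mem {R : ℝ} (hR : 0 ≤ R) (hg : ∀ i, 0 ≤ W.g i)
    (hs : Summable fun n => W.branches.normInf n * R ^ n) :
    W.kneadMatrix.det ∈ PowerSeries.convergentSubring R ∧ ∀ p, IsGerm a b p →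
      W.kneadMatrix.det * W.lapSeries p ∈ PowerSeries.convergentSubring R := by
  have hknead : ∀ j p, IsGerm a b p → W.kneadSeries j p ∈ PowerSeries.convergentSubring R :=
    fun j p hp => W.mem_convergentSubring_of_abs_le hR hs fun n =>
      (W.abs_kneadCoeff_le j n p).trans (W.abs_wordWeight_germWord_le hp n)
  have hM : ∀ i j, W.kneadMatrix i j ∈ PowerSeries.convergentSubring R := by
    intro i j
    refine Subring.sub_mem _ (hknead j _ (W.isGerm_cut_global i)) ?_
    split_ifs with hi
    · exact Subring.zero_mem _
    · exact hknead j _ (W.isGerm_cut_left hi)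
  have hcut : ∀ i, W.cutSeries i ∈ PowerSeries.convergentSubring R := by
    intro i
    rw [cutSeries]
    split_ifs
    · exact Subring.zero_mem _
    · refine W.mem_convergentSubring_of_abs_le hR hs fun n => ?_
      rw [abs_of_nonneg (W.branches.lapCoeff_nonneg hg _ _)]
      exact W.lapCoeff_singleton_le _ n
  refine ⟨Matrix.det_mem_subring _ hM, fun p hp => ?_⟩
  -- Cramer's rule in the form `det • B`, valid for formal power series without inverting the
  -- determinant.
  have hcr : W.kneadMatrix.cramer W.cutSeries = W.kneadMatrix.det • W.baseSeries := by
    rw [Matrix.cramer_eq_adjugate_mulVec, ← W.kneadMatrix_mulVec, Matrix.mulVec_mulVec,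
      Matrix.adjugate_mul, Matrix.smul_mulVec, Matrix.one_mulVec]
  rw [W.lapSeries_eq_sum hp, Finset.mul_sum]
  refine Subring.sum_mem _ fun j _ => ?_
  have hj := congrFun hcr j
  rw [Pi.smul_apply, smul_eq_mul] at hj
  rw [mul_left_comm, ← hj]
  exact Subring.mul_mem _ (hknead j p hp) (Matrix.cramer_mem_subring _ hM hcut j)

end WeightedSystem

/-! ### Growth of the lap coefficients -/

namespace WeightedSystem

variable {a b : ℝ} {ℓ : ℕ} (W : WeightedSystem a b ℓ)

theorem cylinder_succ_subset_init {n : ℕ} (w : Fin (n + 1) → Fin (ℓ + 1)) :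
    W.branches.cylinder (n + 1) w ⊆ W.branches.cylinder n (Fin.init w) := by
  intro x hx
  obtain ⟨y, hy0, hy⟩ := W.branches.mem_cylinder_iff.1 hx
  exact W.branches.mem_cylinder_iff.2 ⟨y, hy0, fun k => hy k.castSucc⟩

/-- A point of the cylinder may run into a cutting point, but its right germ has an itinerary of
every length, and near that germ the cylinder of the itinerary meets the given open one. -/
theorem exists_mem_Z_init_eq {n : ℕ} {v : Fin n → Fin (ℓ + 1)} (hv : v ∈ W.branches.Z n) :
    ∃ w ∈ W.branches.Z (n + 1), Fin.init w = v := by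
  obtain ⟨x, hx, hxab⟩ : ∃ x ∈ W.branches.cylinder n v, x ∈ Ioo a b := by
    rcases n with _ | n
    · obtain ⟨x, hx⟩ := nonempty_Ioo.2 W.left_lt_right
      exact ⟨x, mem_univ _, hx⟩
    · obtain ⟨x, hx⟩ := W.branches.mem_Z.1 hv
      exact ⟨x, hx, W.I_subset_Ioo _ hx.1⟩
  have hp : IsGerm a b (x, true) := Ioo_subset_Ico_self hxab
  have h1 : W.branches.cylinder n v ∈ germNhds (x, true) :=
    mem_nhdsWithin_of_mem_nhds ((W.isOpen_cylinder n v).mem_nhds hx)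
  have h2 := W.cylinder_germWord_mem hp (n + 1)
  have := germNhds_neBot (x, true)
  obtain ⟨y, hy1, hy2⟩ := Filter.nonempty_of_mem (inter_mem h1 h2)
  exact ⟨_, W.branches.mem_Z.2 ⟨y, hy2⟩,
    W.eq_of_mem_cylinder (W.cylinder_succ_subset_init _ hy2) hy1⟩

/-- The sum of the weights `gⁿ` over the cylinders of level `n + 1`. -/
noncomputable def initSum (n : ℕ) : ℝ :=
  ∑ w ∈ W.branches.Z (n + 1), W.branches.wordWeight (Fin.init w)

theorem normOne_le_initSum (hg : ∀ i, 0 ≤ W.g i) (n : ℕ) : W.branches.normOne n ≤ W.initSum n := by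
  classical
  have hex : ∀ v : Fin n → Fin (ℓ + 1), ∃ w : Fin (n + 1) → Fin (ℓ + 1),
      Fin.init w = v ∧ (v ∈ W.branches.Z n → w ∈ W.branches.Z (n + 1)) := by
    intro v
    by_cases hv : v ∈ W.branches.Z n
    · obtain ⟨w, hw, h⟩ := W.exists_mem_Z_init_eq hv
      exact ⟨w, h, fun _ => hw⟩
    -- For inadmissible `v` the added letter is arbitrary: `σ` need only be a section of `Fin.init`,
    -- hence injective.
    · exact ⟨Fin.snoc v 0, Fin.init_snoc _ _, fun h => absurd h hv⟩
  choose σ hσ hσZ using hex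
  have hinj : Function.Injective σ := fun v v' h => by rw [← hσ v, ← hσ v', h]
  calc W.branches.normOne n = ∑ v ∈ W.branches.Z n, W.branches.wordWeight (Fin.init (σ v)) :=
        Finset.sum_congr rfl fun v _ => by
          rw [hσ, abs_of_nonneg (W.branches.wordWeight_nonneg hg v)]
    _ = ∑ w ∈ (W.branches.Z n).image σ, W.branches.wordWeight (Fin.init w) := by
        rw [Finset.sum_image hinj.injOn]
    _ ≤ W.initSum n := by
        refine Finset.sum_le_sum_of_subset_of_nonneg (fun w hw => ?_)
          fun _ _ _ => W.branches.wordWeight_nonneg hg _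
        obtain ⟨v, hv, rfl⟩ := Finset.mem_image.1 hw
        exact hσZ v hv

theorem initSum_le (hg : ∀ i, 0 ≤ W.g i) (n : ℕ) :
    W.initSum n ≤ (ℓ + 1) * W.branches.normOne n := by
  classical
  set e : (Fin (n + 1) → Fin (ℓ + 1)) → Fin (ℓ + 1) × (Fin n → Fin (ℓ + 1)) :=
    fun w => (w (Fin.last n), Fin.init w) with he
  have hinj : Function.Injective e := fun w w' h => by
    rw [← Fin.snoc_init_self w, ← Fin.snoc_init_self w', (Prod.mk.inj h).1, (Prod.mk.inj h).2]
  calc W.initSum n = ∑ p ∈ (W.branches.Z (n + 1)).image e, W.branches.wordWeight p.2 := by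
        rw [Finset.sum_image hinj.injOn]; rfl
    _ ≤ ∑ p ∈ Finset.univ ×ˢ W.branches.Z n, W.branches.wordWeight p.2 := by
        refine Finset.sum_le_sum_of_subset_of_nonneg (fun p hp => ?_)
          fun _ _ _ => W.branches.wordWeight_nonneg hg _
        obtain ⟨w, hw, rfl⟩ := Finset.mem_image.1 hp
        exact Finset.mem_product.2 ⟨Finset.mem_univ _, W.branches.init_mem_Z hw⟩
    _ = (ℓ + 1) * W.branches.normOne n := by
        rw [Finset.sum_product]
        dsimp only
        rw [Finset.sum_const, Finset.card_univ, Fintype.card_fin, nsmul_eq_mul]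
        push_cast
        congr 1
        exact Finset.sum_congr rfl fun v _ =>
          (abs_of_nonneg (W.branches.wordWeight_nonneg hg v)).symm

theorem lapCoeff_le_initSum (hg : ∀ i, 0 ≤ W.g i) (J : Set ℝ) (n : ℕ) :
    W.branches.lapCoeff J n ≤ W.initSum n := by
  rw [BranchSystem.lapCoeff, initSum, Finset.mul_sum]
  refine Finset.sum_le_sum fun w _ => ?_
  have h0 := W.branches.wordWeight_nonneg hg (Fin.init w)
  have h1 : ∀ y, J.indicator (1 : ℝ → ℝ) y ≤ 1 := fun y =>
    Set.indicator_le_self' (fun _ _ => zero_le_one) y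
  have := mul_le_mul_of_nonneg_left (add_le_add
    (h1 (sInf (W.branches.cylinder (n + 1) w))) (h1 (sSup (W.branches.cylinder (n + 1) w)))) h0
  linarith

theorem lapCoeff_Icc (n : ℕ) : W.branches.lapCoeff (Icc a b) n = W.initSum n := by
  rw [BranchSystem.lapCoeff, initSum, Finset.mul_sum]
  refine Finset.sum_congr rfl fun w hw => ?_
  have hne := W.branches.mem_Z.1 hw
  rw [Set.indicator_of_mem (W.Icc_cut_subset _ (W.csInf_cylinder_mem hne)),
    Set.indicator_of_mem (W.Icc_cut_subset _ (W.csSup_cylinder_mem hne))]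
  simp only [Pi.one_apply]
  ring

/-- On `[a, b]` both ends of every cylinder are counted, which gives at least `normOne n`;
discarding each of the points `a` and `b` costs at most `normInf n`. -/
theorem rhoOne_pow_le_lapCoeff_add (hg : ∀ i, 0 ≤ W.g i) (n : ℕ) :
    W.branches.rhoOne ^ n ≤ W.branches.lapCoeff (Ioo a b) n + 2 * W.branches.normInf n := by
  have hab := W.left_lt_right
  have h1 := W.branches.lapCoeff_diff (Ioo_subset_Icc_self : Ioo a b ⊆ Icc a b) n
  rw [Icc_sdiff_Ioo_same hab.le] at h1
  have h2 := W.branches.lapCoeff_diff (show ({a} : Set ℝ) ⊆ {a, b} by simp) n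
  have h3 : ({a, b} : Set ℝ) \ {a} = {b} := by
    ext y
    simp only [Set.mem_sdiff, mem_insert_iff, mem_singleton_iff]
    exact ⟨fun h => h.1.resolve_left h.2, fun h => ⟨Or.inr h, by rw [h]; exact hab.ne'⟩⟩
  rw [h3] at h2
  have h4 := W.branches.rhoOne_pow_le_normOne n
  have h5 := W.normOne_le_initSum hg n
  rw [← W.lapCoeff_Icc] at h5
  linarith [W.lapCoeff_singleton_le a n, W.lapCoeff_singleton_le b n]

/-! ### Convergence of the lap functions -/

theorem rhoOne_pos (hρ : W.branches.rhoInf < W.branches.rhoOne) : 0 < W.branches.rhoOne :=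
  W.branches.rhoInf_nonneg.trans_lt hρ

theorem lapCoeff_mem_convergentSubring (hρ : W.branches.rhoInf < W.branches.rhoOne)
    (hg : ∀ i, 0 ≤ W.g i) (J : Set ℝ) {t : ℝ} (ht : t ∈ Ico 0 (1 / W.branches.rhoOne)) :
    PowerSeries.mk (W.branches.lapCoeff J) ∈ PowerSeries.convergentSubring t := by
  have hpos := W.rhoOne_pos hρ
  rcases ht.1.eq_or_lt with rfl | ht0
  · refine summable_of_ne_finset_zero (s := {0}) fun n hn => ?_
    have : n ≠ 0 := by simpa using hn
    simp [this]
  have h1 : W.branches.rhoOne < 1 / t := by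
    rw [lt_div_iff₀ ht0, mul_comm]
    exact (lt_div_iff₀ hpos).1 ht.2
  obtain ⟨r, hr1, hr2⟩ := exists_between h1
  have hr : 0 < r := hpos.trans hr1
  have hrt : r * t < 1 := (lt_div_iff₀ ht0).1 hr2
  refine Summable.of_norm_bounded_eventually_nat
    ((summable_geometric_of_lt_one (by positivity) hrt).mul_left ((ℓ : ℝ) + 1)) ?_
  filter_upwards [W.branches.eventually_normOne_le_pow hr1] with n hn
  rw [norm_norm, PowerSeries.coeff_mk, norm_mul, norm_pow, Real.norm_of_nonneg ht.1,
    Real.norm_of_nonneg (W.branches.lapCoeff_nonneg hg _ _), mul_pow, ← mul_assoc]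
  gcongr
  exact ((W.lapCoeff_le_initSum hg J n).trans (W.initSum_le hg n)).trans (by gcongr)

theorem lapSeries_mem_convergentSubring (hρ : W.branches.rhoInf < W.branches.rhoOne)
    (hg : ∀ i, 0 ≤ W.g i) (p : ℝ × Bool) {t : ℝ} (ht : t ∈ Ico 0 (1 / W.branches.rhoOne)) :
    W.lapSeries p ∈ PowerSeries.convergentSubring t :=
  W.lapCoeff_mem_convergentSubring hρ hg _ ht

theorem lap_eq_sumAt (J : Set ℝ) (t : ℝ) :
    W.branches.lap J t = PowerSeries.sumAt t (PowerSeries.mk (W.branches.lapCoeff J)) :=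
  tsum_congr fun n => by rw [PowerSeries.coeff_mk, mul_comm]

theorem summable_lap (hρ : W.branches.rhoInf < W.branches.rhoOne)
    (hg : ∀ i, 0 ≤ W.g i) (J : Set ℝ) {t : ℝ} (ht : t ∈ Ico 0 (1 / W.branches.rhoOne)) :
    Summable fun n : ℕ => t ^ n * W.branches.lapCoeff J n := by
  have h := (W.lapCoeff_mem_convergentSubring hρ hg J ht).of_norm
  exact h.congr fun n => by rw [PowerSeries.coeff_mk, mul_comm]

theorem lap_nonneg (hg : ∀ i, 0 ≤ W.g i) (J : Set ℝ) {t : ℝ} (ht : 0 ≤ t) :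
    0 ≤ W.branches.lap J t :=
  tsum_nonneg fun n => mul_nonneg (pow_nonneg ht n) (W.branches.lapCoeff_nonneg hg _ _)

theorem lap_mono (hρ : W.branches.rhoInf < W.branches.rhoOne) (hg : ∀ i, 0 ≤ W.g i)
    {J K : Set ℝ} (h : J ⊆ K) {t : ℝ} (ht : t ∈ Ico 0 (1 / W.branches.rhoOne)) :
    W.branches.lap J t ≤ W.branches.lap K t :=
  (W.summable_lap hρ hg J ht).tsum_le_tsum (fun n => mul_le_mul_of_nonneg_left
    (W.branches.lapCoeff_mono hg h n) (pow_nonneg ht.1 n)) (W.summable_lap hρ hg K ht)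

/-- With one branch there is at most one word of each length. The spectral gap thus guarantees a
cutting point inside `]a, b[`, which makes the lap function positive. -/
theorem rhoOne_le_rhoInf_of_subsingleton (hℓ : ℓ = 0) :
    W.branches.rhoOne ≤ W.branches.rhoInf := by
  subst hℓ
  refine limsup_le_limsup (Eventually.of_forall fun n => ?_)
    (isCoboundedUnder_rpow_one_div W.branches.normOne_nonneg)
    (isBoundedUnder_rpow_one_div W.branches.sum_abs_weight_nonneg W.branches.normInf_nonneg
      fun n => (W.branches.normInf_le_normOne n).trans (W.branches.normOne_le_pow n))
  refine Real.rpow_le_rpow (W.branches.normOne_nonneg n) ?_ (by positivity)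
  rcases (W.branches.Z n).eq_empty_or_nonempty with h | ⟨w, hw⟩
  · simp [BranchSystem.normOne, h, W.branches.normInf_nonneg]
  · have : W.branches.Z n = {w} :=
      Finset.eq_singleton_iff_unique_mem.2 ⟨hw, fun v _ => funext fun k => by
        have h1 := (v k).isLt
        have h2 := (w k).isLt
        exact Fin.ext (by omega)⟩
    rw [BranchSystem.normOne, this, Finset.sum_singleton]
    exact W.branches.abs_wordWeight_le_normInf hw

theorem lapCoeff_Ioo_zero_pos (hρ : W.branches.rhoInf < W.branches.rhoOne)
    (hg : ∀ i, 0 ≤ W.g i) : 0 < W.branches.lapCoeff (Ioo a b) 0 := by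
  have hℓ : ℓ ≠ 0 := fun h => absurd (W.rhoOne_le_rhoInf_of_subsingleton h) (not_le.2 hρ)
  rw [BranchSystem.lapCoeff_eq_sum_endCount]
  refine mul_pos (by norm_num) (Finset.sum_pos' (fun w _ =>
    mul_nonneg (W.branches.wordWeight_nonneg hg _) (endCount_nonneg _ _))
    ⟨fun _ => 0, Finset.mem_univ _, ?_⟩)
  have hcyl : W.branches.cylinder 1 (fun _ => 0) =
      Ioo (W.cut (0 : Fin (ℓ + 1)).castSucc) (W.cut (0 : Fin (ℓ + 1)).succ) := by
    simp [BranchSystem.cylinder, branches, I]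
  have hlt := W.cut_lt_cut_succ 0
  have hmem : W.cut (0 : Fin (ℓ + 1)).succ ∈ Ioo a b := by
    refine ⟨(W.le_cut _).trans_lt hlt, ?_⟩
    have := W.cut_strictMono (show (0 : Fin (ℓ + 1)).succ < Fin.last (ℓ + 1) by
      rw [Fin.lt_def]; simp; omega)
    rwa [W.cut_last] at this
  refine mul_pos (by simp [BranchSystem.wordWeight]) ?_
  have hpos : 0 < endCount (Ioo a b) (W.branches.cylinder 1 (fun _ => 0)) := ?_
  · exact hpos
  rw [hcyl, endCount, csSup_Ioo hlt,
    if_pos (show (Ioo (W.cut (0 : Fin (ℓ + 1)).castSucc) (W.cut (0 : Fin (ℓ + 1)).succ)).Nonempty ∧ _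
      from ⟨nonempty_Ioo.2 hlt, hmem⟩)]
  split_ifs <;> norm_num

theorem lap_Ioo_pos (hρ : W.branches.rhoInf < W.branches.rhoOne) (hg : ∀ i, 0 ≤ W.g i)
    {t : ℝ} (ht : t ∈ Ico 0 (1 / W.branches.rhoOne)) : 0 < W.branches.lap (Ioo a b) t := by
  refine (W.summable_lap hρ hg _ ht).tsum_pos (fun n => mul_nonneg (pow_nonneg ht.1 n)
    (W.branches.lapCoeff_nonneg hg _ _)) 0 ?_
  rw [pow_zero, one_mul]
  exact W.lapCoeff_Ioo_zero_pos hρ hg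

theorem eventually_mem_Ico (hρ : W.branches.rhoInf < W.branches.rhoOne) :
    ∀ᶠ t in 𝓝[<] (1 / W.branches.rhoOne), t ∈ Ico 0 (1 / W.branches.rhoOne) := by
  filter_upwards [Ioo_mem_nhdsLT (one_div_pos.2 (W.rhoOne_pos hρ))] with t ht
  exact Ioo_subset_Ico_self ht

/-- At `t = 1/ρ₁` the `n`-th term is at least `1 - 2 ‖gⁿ‖_∞ / ρ₁ⁿ`, so the series of non-negative
terms diverges there; its partial sums, continuous in `t`, are lower bounds nearby. -/
theorem tendsto_lap_Ioo_atTop (hρ : W.branches.rhoInf < W.branches.rhoOne)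
    (hg : ∀ i, 0 ≤ W.g i) :
    Tendsto (W.branches.lap (Ioo a b)) (𝓝[<] (1 / W.branches.rhoOne)) atTop := by
  set ρ := W.branches.rhoOne with hρ'
  have hpos : 0 < ρ := W.rhoOne_pos hρ
  obtain ⟨R, hR, hs⟩ := W.exists_summable_normInf hρ
  have ht0 : 0 < 1 / ρ := one_div_pos.2 hpos
  set u : ℕ → ℝ := fun n => (1 / ρ) ^ n * W.branches.lapCoeff (Ioo a b) n with hu
  have hu0 : ∀ n, 0 ≤ u n := fun n =>
    mul_nonneg (by positivity) (W.branches.lapCoeff_nonneg hg _ _)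
  have hnot : ¬ Summable u := by
    intro hsum
    have h1 : Summable fun n => u n + 2 * (W.branches.normInf n * R ^ n) :=
      hsum.add (hs.mul_left 2)
    have h2 := h1.tendsto_atTop_zero
    refine absurd (ge_of_tendsto' h2 (b := 1) fun n => ?_) (by norm_num)
    have h3 : (1 / ρ) ^ n * (W.branches.lapCoeff (Ioo a b) n + 2 * W.branches.normInf n) ≥ 1 := by
      calc (1 : ℝ) = (1 / ρ) ^ n * ρ ^ n := by
            rw [← mul_pow, one_div_mul_cancel hpos.ne', one_pow]
        _ ≤ _ := by gcongr; exact W.rhoOne_pow_le_lapCoeff_add hg n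
    have h4 : (1 / ρ) ^ n * W.branches.normInf n ≤ R ^ n * W.branches.normInf n := by
      gcongr
      exact W.branches.normInf_nonneg n
    simp only [hu]
    nlinarith
  have htop := (not_summable_iff_tendsto_nat_atTop_of_nonneg hu0).1 hnot
  rw [tendsto_atTop]
  intro M
  obtain ⟨N, hN⟩ := (htop.eventually_gt_atTop M).exists
  have hcont : Tendsto (fun t : ℝ => ∑ n ∈ Finset.range N, t ^ n * W.branches.lapCoeff (Ioo a b) n)
      (𝓝[<] (1 / ρ)) (𝓝 (∑ n ∈ Finset.range N, u n)) := by
    refine Tendsto.mono_left ?_ nhdsWithin_le_nhds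
    exact (continuous_finsetSum _ fun n _ => by fun_prop).tendsto _
  filter_upwards [hcont.eventually_const_lt hN, W.eventually_mem_Ico hρ] with t h1 h2
  exact h1.le.trans ((W.summable_lap hρ hg _ h2).sum_le_tsum _ fun n _ =>
    mul_nonneg (pow_nonneg h2.1 n) (W.branches.lapCoeff_nonneg hg _ _))

/-- The numerator stays below a series convergent at some `R > 1/ρ₁` while the denominator tends to
infinity. This is why `x⁻` and `x⁺` share one limit. -/
theorem tendsto_lap_singleton_div (hρ : W.branches.rhoInf < W.branches.rhoOne)
    (hg : ∀ i, 0 ≤ W.g i) (x : ℝ) :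
    Tendsto (fun t => W.branches.lap {x} t / W.branches.lap (Ioo a b) t)
      (𝓝[<] (1 / W.branches.rhoOne)) (𝓝 0) := by
  obtain ⟨R, hR, hs⟩ := W.exists_summable_normInf hρ
  have h1 : Tendsto (fun t => (∑' n, W.branches.normInf n * R ^ n) / W.branches.lap (Ioo a b) t)
      (𝓝[<] (1 / W.branches.rhoOne)) (𝓝 0) :=
    (W.tendsto_lap_Ioo_atTop hρ hg).const_div_atTop _
  refine tendsto_of_tendsto_of_tendsto_of_le_of_le' tendsto_const_nhds h1 ?_ ?_
  · filter_upwards [W.eventually_mem_Ico hρ] with t ht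
    exact div_nonneg (W.lap_nonneg hg _ ht.1) (W.lap_nonneg hg _ ht.1)
  · filter_upwards [W.eventually_mem_Ico hρ] with t ht
    refine div_le_div_of_nonneg_right ?_ (W.lap_nonneg hg _ ht.1)
    refine (W.summable_lap hρ hg _ ht).tsum_le_tsum (fun n => ?_) hs
    rw [mul_comm]
    exact mul_le_mul (W.lapCoeff_singleton_le x n) (pow_le_pow_left₀ ht.1 (ht.2.trans hR).le n)
      (pow_nonneg ht.1 n) (W.branches.normInf_nonneg n)

theorem belowGerm_subset_Ioo {p : ℝ × Bool} (hp : IsGerm a b p) : belowGerm a p ⊆ Ioo a b := by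
  rcases p with ⟨x, _ | _⟩
  · exact fun y hy => ⟨hy.1, hy.2.trans_le hp.2⟩
  · exact fun y hy => ⟨hy.1, hy.2.trans_lt hp.2⟩

theorem exists_tendsto_lap_div (hρ : W.branches.rhoInf < W.branches.rhoOne)
    (hg : ∀ i, 0 ≤ W.g i) {p : ℝ × Bool} (hp : IsGerm a b p) :
    ∃ l, Tendsto (fun t => W.branches.lap (belowGerm a p) t / W.branches.lap (Ioo a b) t)
      (𝓝[<] (1 / W.branches.rhoOne)) (𝓝 l) := by
  obtain ⟨R, hR, hs⟩ := W.exists_summable_normInf hρ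
  have ht0 : 0 < 1 / W.branches.rhoOne := one_div_pos.2 (W.rhoOne_pos hρ)
  have hR0 : 0 ≤ R := (ht0.trans hR).le
  obtain ⟨hD, hP⟩ := W.det_mul_lapSeries_mem hR0 hg hs
  have habs : |1 / W.branches.rhoOne| < R := by rwa [abs_of_pos ht0]
  have hq : IsGerm a b (b, false) := ⟨W.left_lt_right, le_rfl⟩
  have heq : ∀ᶠ t in 𝓝[<] (1 / W.branches.rhoOne),
      PowerSeries.sumAt t (W.kneadMatrix.det * W.lapSeries p) /
        PowerSeries.sumAt t (W.kneadMatrix.det * W.lapSeries (b, false)) =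
      W.branches.lap (belowGerm a p) t / W.branches.lap (Ioo a b) t := by
    -- The determinant vanishes at `1/ρ₁` itself, since the lap function diverges there; it can be
    -- cancelled because this zero is isolated.
    have hne := PowerSeries.eventually_sumAt_ne_zero hD
      (by rw [W.constantCoeff_det_kneadMatrix]; exact one_ne_zero) habs
    have hle : 𝓝[<] (1 / W.branches.rhoOne) ≤ 𝓝[≠] (1 / W.branches.rhoOne) :=
      nhdsWithin_mono _ fun y hy => ne_of_lt hy
    have hne' := hne.filter_mono hle
    filter_upwards [hne', W.eventually_mem_Ico hρ] with t h1 h2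
    have hDt := PowerSeries.convergentSubring_anti h2.1 (h2.2.trans hR).le hD
    rw [PowerSeries.sumAt_mul hDt (W.lapSeries_mem_convergentSubring hρ hg _ h2),
      PowerSeries.sumAt_mul hDt (W.lapSeries_mem_convergentSubring hρ hg _ h2),
      mul_div_mul_left _ _ h1, W.lap_eq_sumAt, W.lap_eq_sumAt]
    rfl
  obtain ⟨l, hl⟩ := AnalyticAt.exists_tendsto_div_nhdsLT (C := 1)
    (PowerSeries.analyticAt_sumAt (hP p hp) habs) (PowerSeries.analyticAt_sumAt (hP _ hq) habs) (by
      filter_upwards [heq, W.eventually_mem_Ico hρ] with t h1 h2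
      rw [h1, abs_of_nonneg (div_nonneg (W.lap_nonneg hg _ h2.1) (W.lap_nonneg hg _ h2.1))]
      exact div_le_one_of_le₀ (W.lap_mono hρ hg (belowGerm_subset_Ioo hp) h2)
        (W.lap_nonneg hg _ h2.1))
  exact ⟨l, hl.congr' heq⟩

theorem exists_limit_function (hρ : W.branches.rhoInf < W.branches.rhoOne)
    (hg : ∀ i, 0 ≤ W.g i) : ∃ φ : ℝ → ℝ, ∀ p, IsGerm a b p →
      Tendsto (fun t => W.branches.lap (belowGerm a p) t / W.branches.lap (Ioo a b) t)
        (𝓝[<] (1 / W.branches.rhoOne)) (𝓝 (φ p.1)) := by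
  classical
  have hex : ∀ p, ∃ l, IsGerm a b p →
      Tendsto (fun t => W.branches.lap (belowGerm a p) t / W.branches.lap (Ioo a b) t)
        (𝓝[<] (1 / W.branches.rhoOne)) (𝓝 l) := by
    intro p
    by_cases hp : IsGerm a b p
    · obtain ⟨l, hl⟩ := W.exists_tendsto_lap_div hρ hg hp
      exact ⟨l, fun _ => hl⟩
    · exact ⟨0, fun h => absurd h hp⟩
  choose ψ hψ using hex
  -- The right germ defines the value wherever it exists; at `b` only the left germ is available.
  refine ⟨fun x => if x < b then ψ (x, true) else ψ (x, false), ?_⟩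
  rintro ⟨x, _ | _⟩ hp
  · by_cases hx : x < b
    · have hp' : IsGerm a b (x, true) := ⟨hp.1.le, hx⟩
      have h := (hψ _ hp').sub (W.tendsto_lap_singleton_div hρ hg x)
      simp only [hx, if_true]
      rw [sub_zero] at h
      refine h.congr' ?_
      filter_upwards [W.eventually_mem_Ico hρ] with t ht
      rw [← sub_div]
      congr 1
      rw [BranchSystem.lap, BranchSystem.lap, BranchSystem.lap,
        ← (W.summable_lap hρ hg _ ht).tsum_sub (W.summable_lap hρ hg _ ht)]
      refine tsum_congr fun n => ?_
      rw [← W.lapCoeff_belowGerm_sub hp.1]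
      ring
    · simp only [hx, if_false]
      exact hψ _ hp
  · simp only [show x < b from hp.2, if_true]
    exact hψ _ hp

end WeightedSystem

/-! ### The limit function -/

theorem exists_isGerm_of_mem_Icc {c d x : ℝ} (hcd : c < d) (hx : x ∈ Icc c d) :
    ∃ σ, IsGerm c d (x, σ) := by
  rcases hx.2.eq_or_lt with rfl | h
  · exact ⟨false, hcd, le_rfl⟩
  · exact ⟨true, hx.1, h⟩

namespace WeightedSystem

variable {a b : ℝ} {ℓ : ℕ} (W : WeightedSystem a b ℓ)

/-- `φ` is the limit of the `φ_t` as `t ↗ 1/ρ₁`, on germs of either direction. -/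
def IsLapLimit (φ : ℝ → ℝ) : Prop :=
  ∀ p, IsGerm a b p →
    Tendsto (fun t => W.branches.lap (belowGerm a p) t / W.branches.lap (Ioo a b) t)
      (𝓝[<] (1 / W.branches.rhoOne)) (𝓝 (φ p.1))

theorem isGerm_of_isGerm_cut {i : Fin (ℓ + 1)} {p : ℝ × Bool}
    (hp : IsGerm (W.cut i.castSucc) (W.cut i.succ) p) : IsGerm a b p := by
  rcases p with ⟨x, _ | _⟩
  · exact ⟨(W.le_cut _).trans_lt hp.1, hp.2.trans (W.cut_le _)⟩
  · exact ⟨(W.le_cut _).trans hp.1, hp.2.trans_le (W.cut_le _)⟩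

variable {W} {φ : ℝ → ℝ}

theorem IsLapLimit.left (hφ : W.IsLapLimit φ) : φ a = 0 := by
  have h := hφ (a, true) ⟨le_rfl, W.left_lt_right⟩
  refine tendsto_nhds_unique h ?_
  have : W.branches.lap (belowGerm a (a, true)) = fun _ => 0 := by
    funext t
    simp [belowGerm, BranchSystem.lap, BranchSystem.lapCoeff]
  simp [this]

theorem IsLapLimit.right (hφ : W.IsLapLimit φ) (hρ : W.branches.rhoInf < W.branches.rhoOne)
    (hg : ∀ i, 0 ≤ W.g i) : φ b = 1 := by
  have h := hφ (b, false) ⟨W.left_lt_right, le_rfl⟩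
  refine tendsto_nhds_unique h (tendsto_const_nhds.congr' ?_)
  filter_upwards [W.eventually_mem_Ico hρ] with t ht
  exact (div_self (W.lap_Ioo_pos hρ hg ht).ne').symm

theorem IsLapLimit.monotoneOn (hφ : W.IsLapLimit φ)
    (hρ : W.branches.rhoInf < W.branches.rhoOne) (hg : ∀ i, 0 ≤ W.g i) :
    MonotoneOn φ (Icc a b) := by
  intro x hx y hy hxy
  rcases hxy.eq_or_lt with rfl | hlt
  · exact le_rfl
  have hp : IsGerm a b (x, true) := ⟨hx.1, hlt.trans_le hy.2⟩
  have hq : IsGerm a b (y, false) := ⟨hx.1.trans_lt hlt, hy.2⟩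
  refine le_of_tendsto_of_tendsto (hφ _ hp) (hφ _ hq) ?_
  filter_upwards [W.eventually_mem_Ico hρ] with t ht
  have hsub : belowGerm a (x, true) ⊆ belowGerm a (y, false) :=
    fun z hz => ⟨hz.1, hz.2.trans_lt hlt⟩
  exact div_le_div_of_nonneg_right (W.lap_mono hρ hg hsub ht) (W.lap_nonneg hg _ ht.1)

theorem IsLapLimit.mem_Icc (hφ : W.IsLapLimit φ)
    (hρ : W.branches.rhoInf < W.branches.rhoOne) (hg : ∀ i, 0 ≤ W.g i) {x : ℝ}
    (hx : x ∈ Icc a b) : φ x ∈ Icc (0 : ℝ) 1 := by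
  have hm := hφ.monotoneOn hρ hg
  have hab := W.left_lt_right.le
  exact ⟨hφ.left ▸ hm (left_mem_Icc.2 hab) hx hx.1,
    hφ.right hρ hg ▸ hm hx (right_mem_Icc.2 hab) hx.2⟩

/-- Limit of `lapSeries_sub` as `t ↗ 1/ρ₁`. The directions of the germs are immaterial, since `φ`
depends on base points only, and so the relation reaches the ends of `I_i`. -/
theorem IsLapLimit.sub_eq_fExt (hφ : W.IsLapLimit φ)
    (hρ : W.branches.rhoInf < W.branches.rhoOne) (hg : ∀ i, 0 ≤ W.g i) {i : Fin (ℓ + 1)} {x y : ℝ}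
    (hx : x ∈ Icc (W.cut i.castSucc) (W.cut i.succ))
    (hy : y ∈ Icc (W.cut i.castSucc) (W.cut i.succ)) :
    φ x - φ y = W.s i * W.g i / W.branches.rhoOne * (φ (W.fExt i x) - φ (W.fExt i y)) := by
  obtain ⟨σ, hp⟩ := exists_isGerm_of_mem_Icc (W.cut_lt_cut_succ i) hx
  obtain ⟨τ, hq⟩ := exists_isGerm_of_mem_Icc (W.cut_lt_cut_succ i) hy
  have h1 := (hφ _ (W.isGerm_of_isGerm_cut hp)).sub (hφ _ (W.isGerm_of_isGerm_cut hq))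
  have h2 := (hφ _ (W.isGerm_germMap hp)).sub (hφ _ (W.isGerm_germMap hq))
  have ht : Tendsto (fun t : ℝ => W.s i * W.g i * t) (𝓝[<] (1 / W.branches.rhoOne))
      (𝓝 (W.s i * W.g i * (1 / W.branches.rhoOne))) :=
    Tendsto.mono_left ((continuous_const.mul continuous_id).tendsto _) nhdsWithin_le_nhds
  have h3 := ht.mul h2
  rw [mul_one_div] at h3
  refine tendsto_nhds_unique h1 (h3.congr' ?_)
  filter_upwards [W.eventually_mem_Ico hρ] with t ht
  have hmem := fun p => W.lapSeries_mem_convergentSubring hρ hg p ht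
  have key := congrArg (PowerSeries.sumAt t) (W.lapSeries_sub hp hq)
  rw [PowerSeries.sumAt_sub (hmem _) (hmem _),
    PowerSeries.sumAt_mul (PowerSeries.C_mul_X_mem_convergentSubring _ _)
      (Subring.sub_mem _ (hmem _) (hmem _)), PowerSeries.sumAt_C_mul_X,
    PowerSeries.sumAt_sub (hmem _) (hmem _)] at key
  simp only [lapSeries, ← W.lap_eq_sumAt] at key
  rw [← sub_div, ← sub_div, key, mul_div_assoc]

theorem IsLapLimit.sub_eq (hφ : W.IsLapLimit φ)
    (hρ : W.branches.rhoInf < W.branches.rhoOne) (hg : ∀ i, 0 ≤ W.g i) {i : Fin (ℓ + 1)} {x y : ℝ}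
    (hx : x ∈ W.I i) (hy : y ∈ W.I i) :
    φ x - φ y = W.s i * W.g i / W.branches.rhoOne * (φ (W.f i x) - φ (W.f i y)) := by
  rw [hφ.sub_eq_fExt hρ hg (Ioo_subset_Icc_self hx) (Ioo_subset_Icc_self hy), W.fExt_eqOn i hx,
    W.fExt_eqOn i hy]

theorem abs_coeff_mul (hρ : W.branches.rhoInf < W.branches.rhoOne) (hg : ∀ i, 0 ≤ W.g i)
    (i : Fin (ℓ + 1)) (z : ℝ) :
    |W.s i * W.g i / W.branches.rhoOne * z| = W.g i / W.branches.rhoOne * |z| := by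
  rw [abs_mul, abs_div, abs_mul, W.abs_s, one_mul, abs_of_nonneg (hg i),
    abs_of_pos (W.rhoOne_pos hρ)]

theorem IsLapLimit.abs_sub_le_one (hφ : W.IsLapLimit φ)
    (hρ : W.branches.rhoInf < W.branches.rhoOne) (hg : ∀ i, 0 ≤ W.g i) {x y : ℝ}
    (hx : x ∈ Icc a b) (hy : y ∈ Icc a b) : |φ x - φ y| ≤ 1 := by
  have h1 := hφ.mem_Icc hρ hg hx
  have h2 := hφ.mem_Icc hρ hg hy
  rw [abs_le]
  constructor <;> linarith [h1.1, h1.2, h2.1, h2.2]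

/-- Each letter contributes a factor `g_i / ρ₁`, and after `n` letters the difference is at most 1.
Membership in `[a, b]` is needed for `n = 0`, where the cylinder is the whole line. -/
theorem IsLapLimit.abs_sub_le_of_mem_cylinder (hφ : W.IsLapLimit φ)
    (hρ : W.branches.rhoInf < W.branches.rhoOne) (hg : ∀ i, 0 ≤ W.g i) {n : ℕ}
    {w : Fin n → Fin (ℓ + 1)} {x y : ℝ} (hx : x ∈ W.branches.cylinder n w)
    (hy : y ∈ W.branches.cylinder n w) (hxI : x ∈ Icc a b) (hyI : y ∈ Icc a b) :
    |φ x - φ y| ≤ W.branches.wordWeight w / W.branches.rhoOne ^ n := by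
  induction n generalizing x y with
  | zero => simpa [BranchSystem.wordWeight] using hφ.abs_sub_le_one hρ hg hxI hyI
  | succ n ih =>
    have hpos := W.rhoOne_pos hρ
    have hw : W.branches.wordWeight w = W.g (w 0) * W.branches.wordWeight (Fin.tail w) := by
      conv_lhs => rw [← Fin.cons_self_tail w]
      exact W.branches.wordWeight_cons _ _
    rw [hφ.sub_eq hρ hg hx.1 hy.1, abs_coeff_mul hρ hg, hw, pow_succ', mul_div_mul_comm]
    exact mul_le_mul_of_nonneg_left (ih hx.2 hy.2 (W.f_mapsTo _ hx.1) (W.f_mapsTo _ hy.1))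
      (div_nonneg (hg _) hpos.le)

/-- The same estimate from a germ: its base point may be an end of the cylinder rather than a
member, so the extended branch replaces `f_i`. -/
theorem IsLapLimit.eventually_abs_sub_le (hφ : W.IsLapLimit φ)
    (hρ : W.branches.rhoInf < W.branches.rhoOne) (hg : ∀ i, 0 ≤ W.g i) (n : ℕ) {p : ℝ × Bool}
    (hp : IsGerm a b p) : ∀ᶠ y in germNhds p,
      |φ p.1 - φ y| ≤ W.branches.wordWeight (W.germWord n p) / W.branches.rhoOne ^ n := by
  induction n generalizing p with
  | zero =>
    filter_upwards [Ioo_mem_germNhds hp] with y hy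
    simpa [BranchSystem.wordWeight] using
      hφ.abs_sub_le_one hρ hg hp.mem_Icc (Ioo_subset_Icc_self hy)
  | succ n ih =>
    have hi := W.isGerm_germIdx hp
    have hpos := W.rhoOne_pos hρ
    filter_upwards [W.I_mem_germNhds hi, W.tendsto_germMap hi (ih (W.isGerm_germNext hp))]
      with y hy hy'
    rw [hφ.sub_eq_fExt hρ hg hi.mem_Icc (Ioo_subset_Icc_self hy), W.fExt_eqOn _ hy,
      abs_coeff_mul hρ hg, germWord, BranchSystem.wordWeight_cons, pow_succ', mul_div_mul_comm]
    exact mul_le_mul_of_nonneg_left hy' (div_nonneg (hg _) hpos.le)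

theorem tendsto_normInf_div (hρ : W.branches.rhoInf < W.branches.rhoOne) :
    Tendsto (fun n => W.branches.normInf n / W.branches.rhoOne ^ n) atTop (𝓝 0) := by
  obtain ⟨r, hr1, hr2⟩ := exists_between hρ
  have hr : 0 < r := W.branches.rhoInf_nonneg.trans_lt hr1
  have hpos := W.rhoOne_pos hρ
  have h1 := tendsto_pow_atTop_nhds_zero_of_lt_one (div_nonneg hr.le hpos.le)
    ((div_lt_one hpos).2 hr2)
  refine tendsto_of_tendsto_of_tendsto_of_le_of_le' tendsto_const_nhds h1 ?_ ?_
  · exact Eventually.of_forall fun n => div_nonneg (W.branches.normInf_nonneg n) (by positivity)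
  · filter_upwards [W.branches.eventually_normInf_le_pow hr1] with n hn
    rw [div_pow]
    gcongr

theorem IsLapLimit.tendsto_germ (hφ : W.IsLapLimit φ)
    (hρ : W.branches.rhoInf < W.branches.rhoOne) (hg : ∀ i, 0 ≤ W.g i) {p : ℝ × Bool}
    (hp : IsGerm a b p) : Tendsto φ (germNhds p) (𝓝 (φ p.1)) := by
  have hpos := W.rhoOne_pos hρ
  rw [Metric.tendsto_nhds]
  intro ε hε
  obtain ⟨n, hn⟩ := ((tendsto_normInf_div hρ).eventually_lt_const hε).exists
  filter_upwards [hφ.eventually_abs_sub_le hρ hg n hp] with y hy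
  rw [Real.dist_eq, abs_sub_comm]
  refine (hy.trans ?_).trans_lt hn
  gcongr
  exact (le_abs_self _).trans (W.abs_wordWeight_germWord_le hp n)

theorem IsLapLimit.continuousOn (hφ : W.IsLapLimit φ)
    (hρ : W.branches.rhoInf < W.branches.rhoOne) (hg : ∀ i, 0 ≤ W.g i) :
    ContinuousOn φ (Icc a b) := by
  intro x hx
  have h1 : Tendsto φ (𝓝[Icc a b ∩ Iio x] x) (𝓝 (φ x)) := by
    rcases hx.1.eq_or_lt with rfl | h
    · have : Icc a b ∩ Iio a = ∅ := by
        ext y; simp only [mem_inter_iff, mem_Iio, mem_empty_iff_false, iff_false]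
        intro h; linarith [h.1.1, h.2]
      simp [this]
    · exact (hφ.tendsto_germ hρ hg (p := (x, false)) ⟨h, hx.2⟩).mono_left
        (nhdsWithin_mono _ inter_subset_right)
  have h2 : Tendsto φ (𝓝[Icc a b ∩ Ioi x] x) (𝓝 (φ x)) := by
    rcases hx.2.eq_or_lt with rfl | h
    · have : Icc a x ∩ Ioi x = ∅ := by
        ext y; simp only [mem_inter_iff, mem_Ioi, mem_empty_iff_false, iff_false]
        intro h; linarith [h.1.2, h.2]
      simp [this]
    · exact (hφ.tendsto_germ hρ hg (p := (x, true)) ⟨hx.1, h⟩).mono_left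
        (nhdsWithin_mono _ inter_subset_right)
  have hsub : Icc a b ⊆ (Icc a b ∩ Iio x) ∪ (Icc a b ∩ Ioi x) ∪ {x} := by
    intro y hy
    rcases lt_trichotomy y x with h | h | h
    · exact Or.inl (Or.inl ⟨hy, h⟩)
    · exact Or.inr h
    · exact Or.inl (Or.inr ⟨hy, h⟩)
  have h3 : ContinuousWithinAt φ ((Icc a b ∩ Iio x) ∪ (Icc a b ∩ Ioi x) ∪ {x}) x :=
    (ContinuousWithinAt.union h1 h2).union continuousWithinAt_singleton
  exact h3.mono hsub

theorem IsLapLimit.congr {ψ : ℝ → ℝ} (hφ : W.IsLapLimit φ) (h : EqOn φ ψ (Icc a b)) :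
    W.IsLapLimit ψ := fun p hp => h hp.mem_Icc ▸ hφ p hp

theorem exists_continuous_isLapLimit (hρ : W.branches.rhoInf < W.branches.rhoOne)
    (hg : ∀ i, 0 ≤ W.g i) :
    ∃ φ, W.IsLapLimit φ ∧ Continuous φ ∧ ∀ x, φ x ∈ Icc (0 : ℝ) 1 := by
  obtain ⟨φ, hφ⟩ := W.exists_limit_function hρ hg
  have hφ' : W.IsLapLimit φ := hφ
  have hab := W.left_lt_right.le
  -- Extending `φ` by constants outside `[a, b]` makes it continuous with values in `[0, 1]`
  -- everywhere and leaves the limits unchanged.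
  refine ⟨IccExtend hab ((Icc a b).domRestrict φ), hφ'.congr fun x hx => ?_, ?_,
    fun x => hφ'.mem_Icc hρ hg (projIcc a b hab x).2⟩
  · rw [IccExtend_of_mem _ _ hx]; rfl
  · exact (hφ'.continuousOn hρ hg).domRestrict.Icc_extend'

theorem IsLapLimit.image_Icc (hφ : W.IsLapLimit φ)
    (hρ : W.branches.rhoInf < W.branches.rhoOne) (hg : ∀ i, 0 ≤ W.g i) :
    φ '' Icc a b = Icc 0 1 := by
  refine Subset.antisymm ?_ ?_
  · rintro _ ⟨x, hx, rfl⟩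
    exact hφ.mem_Icc hρ hg hx
  · have := intermediate_value_Icc W.left_lt_right.le (hφ.continuousOn hρ hg)
    rwa [hφ.left, hφ.right hρ hg] at this

/-! ### The affine model -/

variable (W φ) in
/-- The affine branches of the model. -/
noncomputable def affineBranch (i : Fin (ℓ + 1)) (y : ℝ) : ℝ :=
  W.s i * W.branches.rhoOne / W.g i * y +
    (φ (W.f i ((W.cut i.castSucc + W.cut i.succ) / 2)) -
      W.s i * W.branches.rhoOne / W.g i * φ ((W.cut i.castSucc + W.cut i.succ) / 2))

theorem mem_survivors {i : Fin (ℓ + 1)} : i ∈ W.survivors φ ↔ (W.image φ i).Nonempty := by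
  simp [survivors]

/-- For `g_i = 0` the functional equation makes `φ` constant on `I_i`, and a single point has empty
interior. -/
theorem IsLapLimit.weight_pos (hφ : W.IsLapLimit φ)
    (hρ : W.branches.rhoInf < W.branches.rhoOne) (hg : ∀ i, 0 ≤ W.g i) {i : Fin (ℓ + 1)}
    (hi : i ∈ W.survivors φ) : 0 < W.g i := by
  refine lt_of_le_of_ne (hg i) fun h0 => ?_
  obtain ⟨y, hy⟩ := mem_survivors.1 hi
  have hsub : (φ '' W.I i).Subsingleton := by
    rintro _ ⟨x, hx, rfl⟩ _ ⟨z, hz, rfl⟩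
    have := hφ.sub_eq hρ hg hx hz
    rw [← h0] at this
    simp only [mul_zero, zero_div, zero_mul] at this
    linarith
  rw [image, interior_eq_empty_iff_dense_compl.2 (hsub.countable.dense_compl ℝ)] at hy
  exact hy

/-- This is the functional equation with the midpoint of `I_i` as second point, solved for `φ (f_i
x)` by means of `s_i² = 1`. -/
theorem IsLapLimit.affineBranch_apply (hφ : W.IsLapLimit φ)
    (hρ : W.branches.rhoInf < W.branches.rhoOne) (hg : ∀ i, 0 ≤ W.g i) {i : Fin (ℓ + 1)}
    (hi : 0 < W.g i) {x : ℝ} (hx : x ∈ W.I i) :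
    W.affineBranch φ i (φ x) = φ (W.f i x) := by
  have hpos := W.rhoOne_pos hρ
  have hm : (W.cut i.castSucc + W.cut i.succ) / 2 ∈ W.I i := by
    have := W.cut_lt_cut_succ i
    exact ⟨by linarith, by linarith⟩
  have h := hφ.sub_eq hρ hg hx hm
  have hs := W.s_mul_s i
  rw [affineBranch]
  have h2 : W.s i * W.branches.rhoOne / W.g i *
      (φ x - φ ((W.cut i.castSucc + W.cut i.succ) / 2)) =
      φ (W.f i x) - φ (W.f i ((W.cut i.castSucc + W.cut i.succ) / 2)) := by
    rw [h]
    field_simp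
    rw [pow_two, hs, one_mul]
  linarith

theorem image_subset (i : Fin (ℓ + 1)) : W.image φ i ⊆ φ '' W.I i := interior_subset

theorem image_subset_Ioo (hm : MonotoneOn φ (Icc a b)) (i : Fin (ℓ + 1)) :
    W.image φ i ⊆ Ioo (φ (W.cut i.castSucc)) (φ (W.cut i.succ)) := by
  have hl := W.Icc_cut_subset i (left_mem_Icc.2 (W.cut_lt_cut_succ i).le)
  have hr := W.Icc_cut_subset i (right_mem_Icc.2 (W.cut_lt_cut_succ i).le)
  rw [image, ← interior_Icc]
  refine interior_mono ?_
  rintro _ ⟨x, hx, rfl⟩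
  have hxI := W.Icc_cut_subset i (Ioo_subset_Icc_self hx)
  exact ⟨hm hl hxI hx.1.le, hm hxI hr hx.2.le⟩

/-- A plateau of `φ` may straddle a cutting point, but its value is then an end of the image
interval; taking interiors removes it. -/
theorem mem_I_of_mem_image (hm : MonotoneOn φ (Icc a b)) {i : Fin (ℓ + 1)} {x : ℝ}
    (hx : x ∈ Icc a b) (h : φ x ∈ W.image φ i) : x ∈ W.I i := by
  have hl := W.Icc_cut_subset i (left_mem_Icc.2 (W.cut_lt_cut_succ i).le)
  have hr := W.Icc_cut_subset i (right_mem_Icc.2 (W.cut_lt_cut_succ i).le)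
  have h' := image_subset_Ioo hm i h
  constructor
  · by_contra! hle
    exact absurd (hm hx hl hle) (not_le.2 h'.1)
  · by_contra! hle
    exact absurd (hm hr hx hle) (not_le.2 h'.2)

theorem IsLapLimit.mem_cylinder_of_mem_model (hφ : W.IsLapLimit φ)
    (hρ : W.branches.rhoInf < W.branches.rhoOne) (hg : ∀ i, 0 ≤ W.g i) {n : ℕ}
    {w : Fin n → {i // i ∈ W.survivors φ}} {x : ℝ} (hx : x ∈ Icc a b)
    (h : φ x ∈ (W.model φ (W.affineBranch φ)).cylinder n w) :
    x ∈ W.branches.cylinder n (fun k => (w k).1) := by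
  induction n generalizing x with
  | zero => exact mem_univ _
  | succ n ih =>
    have hxI : x ∈ W.I (w 0).1 := mem_I_of_mem_image (hφ.monotoneOn hρ hg) hx h.1
    refine ⟨hxI, ih (W.f_mapsTo _ hxI) ?_⟩
    have h2 : W.affineBranch φ (w 0).1 (φ x) ∈
      (W.model φ (W.affineBranch φ)).cylinder n (Fin.tail w) := h.2
    rwa [hφ.affineBranch_apply hρ hg (hφ.weight_pos hρ hg (w 0).2) hxI] at h2

theorem cylinder_nonempty_of_model (hφ : W.IsLapLimit φ)
    (hρ : W.branches.rhoInf < W.branches.rhoOne) (hg : ∀ i, 0 ≤ W.g i) {n : ℕ}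
    {w : Fin n → {i // i ∈ W.survivors φ}}
    (h : ((W.model φ (W.affineBranch φ)).cylinder n w).Nonempty) :
    (W.branches.cylinder n (fun k => (w k).1)).Nonempty := by
  rcases n with _ | n
  · exact ⟨0, mem_univ _⟩
  · obtain ⟨y, hy⟩ := h
    obtain ⟨x, hx, rfl⟩ := image_subset _ hy.1
    exact ⟨x, hφ.mem_cylinder_of_mem_model hρ hg (Ioo_subset_Icc_self (W.I_subset_Ioo _ hx)) hy⟩

theorem model_normOne_le (hφ : W.IsLapLimit φ)
    (hρ : W.branches.rhoInf < W.branches.rhoOne) (hg : ∀ i, 0 ≤ W.g i) (n : ℕ) :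
    (W.model φ (W.affineBranch φ)).normOne n ≤ W.branches.normOne n := by
  classical
  set e : (Fin n → {i // i ∈ W.survivors φ}) → (Fin n → Fin (ℓ + 1)) := fun w k => (w k).1 with he
  have hinj : Function.Injective e := fun w w' h => funext fun k => Subtype.ext (congrFun h k)
  calc (W.model φ (W.affineBranch φ)).normOne n
      = ∑ v ∈ ((W.model φ (W.affineBranch φ)).Z n).image e, |W.branches.wordWeight v| := by
        rw [Finset.sum_image hinj.injOn]; rfl
    _ ≤ W.branches.normOne n := by
        refine Finset.sum_le_sum_of_subset_of_nonneg (fun v hv => ?_) fun _ _ _ => abs_nonneg _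
        obtain ⟨w, hw, rfl⟩ := Finset.mem_image.1 hv
        exact W.branches.mem_Z.2
          (cylinder_nonempty_of_model hφ hρ hg (BranchSystem.mem_Z _ |>.1 hw))

/-- Affine branches of non-zero slope are open maps, so they carry the interior of the image of a
cylinder into the interior of the image of its tail cylinder. -/
theorem IsLapLimit.interior_subset_model (hφ : W.IsLapLimit φ)
    (hρ : W.branches.rhoInf < W.branches.rhoOne) (hg : ∀ i, 0 ≤ W.g i) {n : ℕ}
    {v : Fin n → Fin (ℓ + 1)} {y : ℝ} (hy : y ∈ interior (φ '' W.branches.cylinder n v)) :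
    ∃ w : Fin n → {i // i ∈ W.survivors φ}, (fun k => (w k).1) = v ∧
      y ∈ (W.model φ (W.affineBranch φ)).cylinder n w := by
  induction n generalizing y with
  | zero => exact ⟨Fin.elim0, Subsingleton.elim _ _, mem_univ _⟩
  | succ n ih =>
    have hpos := W.rhoOne_pos hρ
    have hyI : y ∈ W.image φ (v 0) := interior_mono (image_mono inter_subset_left) hy
    have hsurv : v 0 ∈ W.survivors φ := mem_survivors.2 ⟨y, hyI⟩
    have hgpos := hφ.weight_pos hρ hg hsurv
    have hslope : W.s (v 0) * W.branches.rhoOne / W.g (v 0) ≠ 0 := by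
      have hs : W.s (v 0) ≠ 0 := fun h => by simpa [h] using W.abs_s (v 0)
      exact div_ne_zero (mul_ne_zero hs hpos.ne') hgpos.ne'
    have hopen : IsOpenMap (W.affineBranch φ (v 0)) :=
      (Homeomorph.addRight _).isOpenMap.comp (Homeomorph.mulLeft₀ _ hslope).isOpenMap
    have hnext : W.affineBranch φ (v 0) y ∈
        interior (φ '' W.branches.cylinder n (Fin.tail v)) := by
      have h1 : W.affineBranch φ (v 0) '' (φ '' W.branches.cylinder (n + 1) v) ⊆
          φ '' W.branches.cylinder n (Fin.tail v) := by
        rintro _ ⟨_, ⟨x, hx, rfl⟩, rfl⟩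
        exact ⟨W.f (v 0) x, hx.2, (hφ.affineBranch_apply hρ hg hgpos hx.1).symm⟩
      exact interior_mono h1 (hopen.image_interior_subset _ (mem_image_of_mem _ hy))
    obtain ⟨w, hw, hmem⟩ := ih hnext
    refine ⟨Fin.cons ⟨v 0, hsurv⟩ w, ?_, hyI, hmem⟩
    funext k
    refine Fin.cases rfl (fun k => ?_) k
    exact congrFun hw k

variable (W) in
-- The points missed at level `n + 1` are cutting points or preimages, under finitely many injective
-- branches, of points missed at level `n`.
theorem finite_diff_cylinders (n : ℕ) :
    (Icc a b \ ⋃ w : Fin n → Fin (ℓ + 1), W.branches.cylinder n w).Finite := by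
  induction n with
  | zero =>
    convert Set.finite_empty
    refine Set.sdiff_eq_empty.2 fun x _ => mem_iUnion.2 ⟨Fin.elim0, mem_univ _⟩
  | succ n ih =>
    have hfin : ∀ i, (W.I i ∩ W.f i ⁻¹'
        (Icc a b \ ⋃ w : Fin n → Fin (ℓ + 1), W.branches.cylinder n w)).Finite := by
      intro i
      refine Set.Finite.of_finite_image (f := W.f i) (ih.subset ?_) ?_
      · rintro _ ⟨x, hx, rfl⟩
        exact hx.2
      · refine InjOn.mono inter_subset_left ?_
        rcases W.f_strict i with h | h
        exacts [h.injOn, h.injOn]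
    refine ((Set.finite_range W.cut).union (Set.finite_iUnion hfin)).subset ?_
    rintro x ⟨hx, hxn⟩
    rcases hx.2.eq_or_lt with rfl | hxb
    · exact Or.inl ⟨_, W.cut_last⟩
    obtain ⟨i, hi⟩ := W.exists_mem_Ico ⟨hx.1, hxb⟩
    rcases hi.1.eq_or_lt with h | h
    · exact Or.inl ⟨_, h⟩
    · have hxI : x ∈ W.I i := ⟨h, hi.2⟩
      refine Or.inr (mem_iUnion.2 ⟨i, hxI, W.f_mapsTo i hxI, fun hmem => hxn ?_⟩)
      obtain ⟨w, hw⟩ := mem_iUnion.1 hmem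
      exact mem_iUnion.2 ⟨Fin.cons i w, hxI, hw⟩

open MeasureTheory in
-- A length count: the images of the cylinders cover `[0, 1]` up to a finite set, each has length at
-- most its weight over `ρ₁ⁿ`, and those with non-empty interior give admissible words of the model.
theorem IsLapLimit.rhoOne_pow_le_model_normOne (hφ : W.IsLapLimit φ)
    (hρ : W.branches.rhoInf < W.branches.rhoOne) (hg : ∀ i, 0 ≤ W.g i) (n : ℕ) :
    W.branches.rhoOne ^ n ≤ (W.model φ (W.affineBranch φ)).normOne n := by
  classical
  have hpos := W.rhoOne_pos hρ
  set V : (Fin n → Fin (ℓ + 1)) → Set ℝ := fun w => φ '' (Icc a b ∩ W.branches.cylinder n w) with hV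
  set G : Finset (Fin n → Fin (ℓ + 1)) :=
    Finset.univ.filter fun w => (interior (V w)).Nonempty with hG
  have hwn : ∀ w : Fin n → Fin (ℓ + 1), 0 ≤ W.branches.wordWeight w :=
    fun w => W.branches.wordWeight_nonneg hg w
  have hvol : ∀ w, volume (V w) ≤
      ENNReal.ofReal (if w ∈ G then W.branches.wordWeight w / W.branches.rhoOne ^ n else 0) := by
    intro w
    split_ifs with hw
    · refine (Real.volume_le_diam _).trans (Metric.ediam_le ?_)
      rintro _ ⟨x, hx, rfl⟩ _ ⟨y, hy, rfl⟩
      rw [edist_dist]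
      refine ENNReal.ofReal_le_ofReal ?_
      exact hφ.abs_sub_le_of_mem_cylinder hρ hg hx.2 hy.2 hx.1 hy.1
    · have hempty : ¬ (interior (V w)).Nonempty := fun h => hw (by simp [hG, h])
      have hconn : (V w).OrdConnected := by
        have h1 : IsPreconnected (Icc a b ∩ W.branches.cylinder n w) :=
          (ordConnected_Icc.inter (W.ordConnected_cylinder n w)).isPreconnected
        exact (h1.image _ ((hφ.continuousOn hρ hg).mono inter_subset_left)).ordConnected
      -- A connected subset of the line with empty interior is at most a point, so it has length
      -- zero.
      have hsub : (V w).Subsingleton := by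
        by_contra hns
        obtain ⟨x, hx, y, hy, hne⟩ := Set.not_subsingleton_iff.1 hns
        rcases lt_or_gt_of_ne hne with h | h
        · refine hempty (((nonempty_Ioo.2 h).mono ?_))
          rw [← interior_Icc]
          exact interior_mono (hconn.out hx hy)
        · refine hempty (((nonempty_Ioo.2 h).mono ?_))
          rw [← interior_Icc]
          exact interior_mono (hconn.out hy hx)
      rw [hsub.measure_zero]
      exact zero_le
  have hcover : Icc (0 : ℝ) 1 ⊆ (⋃ w, V w) ∪
      φ '' (Icc a b \ ⋃ w : Fin n → Fin (ℓ + 1), W.branches.cylinder n w) := by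
    rw [← hφ.image_Icc hρ hg]
    rintro _ ⟨x, hx, rfl⟩
    by_cases h : x ∈ ⋃ w : Fin n → Fin (ℓ + 1), W.branches.cylinder n w
    · obtain ⟨w, hw⟩ := mem_iUnion.1 h
      exact Or.inl (mem_iUnion.2 ⟨w, x, ⟨hx, hw⟩, rfl⟩)
    · exact Or.inr ⟨x, ⟨hx, h⟩, rfl⟩
  have hone : (1 : ENNReal) ≤
      ENNReal.ofReal (∑ w ∈ G, W.branches.wordWeight w / W.branches.rhoOne ^ n) := by
    calc (1 : ENNReal) = volume (Icc (0 : ℝ) 1) := by simp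
      _ ≤ volume (⋃ w, V w) + volume
          (φ '' (Icc a b \ ⋃ w : Fin n → Fin (ℓ + 1), W.branches.cylinder n w)) :=
        (measure_mono hcover).trans (measure_union_le _ _)
      _ = volume (⋃ w, V w) := by
        rw [((W.finite_diff_cylinders n).image φ).measure_zero, add_zero]
      _ ≤ ∑ w, volume (V w) := measure_iUnion_fintype_le _ _
      _ ≤ ∑ w, ENNReal.ofReal
          (if w ∈ G then W.branches.wordWeight w / W.branches.rhoOne ^ n else 0) :=
        Finset.sum_le_sum fun w _ => hvol w
      _ = ENNReal.ofReal (∑ w ∈ G, W.branches.wordWeight w / W.branches.rhoOne ^ n) := by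
        rw [← ENNReal.ofReal_sum_of_nonneg]
        · congr 1
          rw [← Finset.sum_filter]
          congr 1
          ext w
          simp
        · intro w _
          split_ifs
          exacts [div_nonneg (hwn w) (by positivity), le_rfl]
  rw [ENNReal.one_le_ofReal, ← Finset.sum_div, one_le_div (by positivity)] at hone
  refine hone.trans ?_
  set e : (Fin n → {i // i ∈ W.survivors φ}) → (Fin n → Fin (ℓ + 1)) := fun w k => (w k).1 with he
  have hinj : Function.Injective e := fun w w' h => funext fun k => Subtype.ext (congrFun h k)
  calc ∑ w ∈ G, W.branches.wordWeight w
      ≤ ∑ w ∈ ((W.model φ (W.affineBranch φ)).Z n).image e, |W.branches.wordWeight w| := by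
        refine (Finset.sum_le_sum_of_subset_of_nonneg (fun w hw => ?_)
          fun _ _ _ => hwn _).trans (Finset.sum_le_sum fun w _ => le_abs_self _)
        obtain ⟨y, hy⟩ := (Finset.mem_filter.1 hw).2
        obtain ⟨v, hv, hyv⟩ := hφ.interior_subset_model hρ hg
          (interior_mono (image_mono inter_subset_right) hy)
        exact Finset.mem_image.2 ⟨v, (BranchSystem.mem_Z _).2 ⟨y, hyv⟩, hv⟩
    _ = (W.model φ (W.affineBranch φ)).normOne n := by
        rw [Finset.sum_image hinj.injOn]; rfl

theorem IsLapLimit.model_rhoOne (hφ : W.IsLapLimit φ)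
    (hρ : W.branches.rhoInf < W.branches.rhoOne) (hg : ∀ i, 0 ≤ W.g i) :
    (W.model φ (W.affineBranch φ)).rhoOne = W.branches.rhoOne := by
  refine le_antisymm ?_ ?_
  · refine limsup_le_limsup (Eventually.of_forall fun n => ?_)
      (isCoboundedUnder_rpow_one_div (BranchSystem.normOne_nonneg _))
      (isBoundedUnder_rpow_one_div W.branches.sum_abs_weight_nonneg W.branches.normOne_nonneg
        W.branches.normOne_le_pow)
    exact Real.rpow_le_rpow (BranchSystem.normOne_nonneg _ n) (model_normOne_le hφ hρ hg n)
      (by positivity)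
  · exact le_limsup_of_pow_le (BranchSystem.sum_abs_weight_nonneg _) (W.rhoOne_pos hρ).le
      (BranchSystem.normOne_nonneg _) (BranchSystem.normOne_le_pow _)
      (hφ.rhoOne_pow_le_model_normOne hρ hg)

/-! ### Continuous systems -/

/-- By monotonicity `φ` is constant on `[x, y]`, hence `φ ∘ F` is constant on each piece `[x, y] ∩
I_i`: through the affine branch if `g_i > 0`, by `h0` if `g_i = 0`. With the cutting points this
leaves finitely many values, and a finite connected image is a point. -/
theorem IsLapLimit.eq_of_eq (hφ : W.IsLapLimit φ) (hcont : Continuous φ)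
    (hρ : W.branches.rhoInf < W.branches.rhoOne) (hg : ∀ i, 0 ≤ W.g i) {F : ℝ → ℝ}
    (hF : ContinuousOn F (Icc a b)) (hFf : ∀ i, EqOn F (W.f i) (W.I i))
    (h0 : ∀ i, W.g i = 0 → ∀ x ∈ W.I i, ∀ y ∈ W.I i, φ (W.f i x) = φ (W.f i y)) {x y : ℝ}
    (hx : x ∈ Icc a b) (hy : y ∈ Icc a b) (hxy : φ x = φ y) : φ (F x) = φ (F y) := by
  wlog hle : x ≤ y generalizing x y
  · exact (this hy hx hxy.symm (le_of_not_ge hle)).symm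
  have hpos := W.rhoOne_pos hρ
  have hsub : Icc x y ⊆ Icc a b := Icc_subset_Icc hx.1 hy.2
  have hm := hφ.monotoneOn hρ hg
  have hconst : ∀ z ∈ Icc x y, φ z = φ x := fun z hz =>
    le_antisymm (hxy ▸ hm (hsub hz) hy hz.2) (hm hx (hsub hz) hz.1)
  have hfin : ((fun z => φ (F z)) '' Icc x y).Finite := by
    have hpiece : ∀ i, ((fun z => φ (F z)) '' (Icc x y ∩ W.I i)).Finite := by
      intro i
      refine Set.Subsingleton.finite ?_
      rintro _ ⟨z, hz, rfl⟩ _ ⟨u, hu, rfl⟩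
      simp only [hFf i hz.2, hFf i hu.2]
      rcases (hg i).eq_or_lt with h | h
      · exact h0 i h.symm z hz.2 u hu.2
      · rw [← hφ.affineBranch_apply hρ hg h hz.2, ← hφ.affineBranch_apply hρ hg h hu.2,
          hconst z hz.1, hconst u hu.1]
    refine (((Set.finite_range W.cut).image fun z => φ (F z)).union
      (Set.finite_iUnion hpiece)).subset ?_
    rintro _ ⟨z, hz, rfl⟩
    have hz' := hsub hz
    rcases hz'.2.eq_or_lt with h | hzb
    · exact Or.inl ⟨z, ⟨_, W.cut_last.trans h.symm⟩, rfl⟩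
    obtain ⟨i, hi⟩ := W.exists_mem_Ico ⟨hz'.1, hzb⟩
    rcases hi.1.eq_or_lt with h | h
    · exact Or.inl ⟨z, ⟨_, h⟩, rfl⟩
    · exact Or.inr (mem_iUnion.2 ⟨i, z, ⟨hz, h, hi.2⟩, rfl⟩)
  have hpre : IsPreconnected ((fun z => φ (F z)) '' Icc x y) :=
    isPreconnected_Icc.image _ (hcont.comp_continuousOn (hF.mono hsub))
  exact hfin.countable.isTotallyDisconnected _ Subset.rfl hpre
    (mem_image_of_mem _ (left_mem_Icc.2 hle)) (mem_image_of_mem _ (right_mem_Icc.2 hle))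

theorem IsLapLimit.exists_factor (hφ : W.IsLapLimit φ) (hcont : Continuous φ)
    (hρ : W.branches.rhoInf < W.branches.rhoOne) (hg : ∀ i, 0 ≤ W.g i) {F : ℝ → ℝ}
    (hF : ContinuousOn F (Icc a b)) (hFf : ∀ i, EqOn F (W.f i) (W.I i))
    (h0 : ∀ i, W.g i = 0 → ∀ x ∈ W.I i, ∀ y ∈ W.I i, φ (W.f i x) = φ (W.f i y)) :
    ∃ Ft : ℝ → ℝ, ContinuousOn Ft (Icc 0 1) ∧ ∀ x ∈ Icc a b, Ft (φ x) = φ (F x) := by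
  classical
  have himg := hφ.image_Icc hρ hg
  set Ft : ℝ → ℝ := fun y => if h : ∃ x ∈ Icc a b, φ x = y then φ (F h.choose) else 0 with hFt
  have hcomp : ∀ x ∈ Icc a b, Ft (φ x) = φ (F x) := by
    intro x hx
    have h : ∃ z ∈ Icc a b, φ z = φ x := ⟨x, hx, rfl⟩
    rw [hFt]
    dsimp only
    rw [dif_pos h]
    exact hφ.eq_of_eq hcont hρ hg hF hFf h0 h.choose_spec.1 hx h.choose_spec.2
  refine ⟨Ft, ?_, hcomp⟩
  have hmaps : MapsTo φ (Icc a b) (Icc 0 1) := fun x hx => hφ.mem_Icc hρ hg hx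
  set π : Icc a b → Icc (0 : ℝ) 1 := hmaps.restrict φ (Icc a b) (Icc 0 1) with hπ
  have hπc : Continuous π := hcont.continuousOn.mapsToRestrict hmaps
  have hπs : Function.Surjective π := by
    rintro ⟨y, hy⟩
    rw [← himg] at hy
    obtain ⟨x, hx, rfl⟩ := hy
    exact ⟨⟨x, hx⟩, rfl⟩
  -- A continuous surjection from a compact space onto a Hausdorff space is a quotient map, so
  -- continuity of `Ft` may be tested after composition with `π`.
  have hq : IsQuotientMap π := hπc.isClosedMap.isQuotientMap hπc hπs
  rw [continuousOn_iff_continuous_domRestrict, hq.continuous_iff]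
  have : (Icc (0 : ℝ) 1).domRestrict Ft ∘ π = (Icc a b).domRestrict fun x => φ (F x) := by
    funext x
    exact hcomp x.1 x.2
  rw [this]
  exact (hcont.comp_continuousOn hF).domRestrict

end WeightedSystem

theorem mainTheorem6 {a b : ℝ} {ℓ : ℕ} (W : WeightedSystem a b ℓ)
    (hρ : W.branches.rhoInf < W.branches.rhoOne) (hg : ∀ i, 0 ≤ W.g i) :
    (∀ t ∈ Ico 0 (1 / W.branches.rhoOne),
      Summable (fun n : ℕ => t ^ n * W.branches.lapCoeff (Ioo a b) n) ∧
      0 < W.branches.lap (Ioo a b) t) ∧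
    ∃ φ : ℝ → ℝ,
      ContinuousOn φ (Icc a b) ∧ MonotoneOn φ (Icc a b) ∧ φ '' Icc a b = Icc 0 1 ∧
      -- `φ` is the limit of `φ_t` as `t ↗ 1/ρ₁`, on germs of either direction
      (∀ x ∈ Ioc a b,
        Tendsto (fun t => W.phiMinus t x) (𝓝[<] (1 / W.branches.rhoOne)) (𝓝 (φ x))) ∧
      (∀ x ∈ Ico a b,
        Tendsto (fun t => W.phiPlus t x) (𝓝[<] (1 / W.branches.rhoOne)) (𝓝 (φ x))) ∧
      ∃ ft : Fin (ℓ + 1) → ℝ → ℝ,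
        -- A
        (∀ i ∈ W.survivors φ,
          0 < W.g i ∧
          (∃ d : ℝ, ∀ y, ft i y = W.s i * W.branches.rhoOne / W.g i * y + d) ∧
          MapsTo (ft i) (W.image φ i) (Icc 0 1) ∧
          ∀ x ∈ W.I i, ft i (φ x) = φ (W.f i x)) ∧
        -- B
        ((W.model φ ft).rhoOne = W.branches.rhoOne ∧
          (W.model φ ft).pressure = W.branches.pressure) ∧
        -- C
        (∀ F : ℝ → ℝ, ContinuousOn F (Icc a b) → (∀ i, EqOn F (W.f i) (W.I i)) →
          (∀ i, W.g i = 0 → ∀ x ∈ W.I i, ∀ y ∈ W.I i, φ (W.f i x) = φ (W.f i y)) →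
          ∃ Ft : ℝ → ℝ, ContinuousOn Ft (Icc 0 1) ∧ MapsTo Ft (Icc 0 1) (Icc 0 1) ∧
            (∀ i ∈ W.survivors φ, EqOn Ft (ft i) (W.image φ i)) ∧
            ∀ x ∈ Icc a b, Ft (φ x) = φ (F x)) := by
  refine ⟨fun t ht => ⟨W.summable_lap hρ hg _ ht, W.lap_Ioo_pos hρ hg ht⟩, ?_⟩
  obtain ⟨φ, hφ, hcont, hrange⟩ := WeightedSystem.exists_continuous_isLapLimit hρ hg
  refine ⟨φ, hcont.continuousOn, hφ.monotoneOn hρ hg, hφ.image_Icc hρ hg,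
    fun x hx => hφ (x, false) hx, fun x hx => hφ (x, true) hx, W.affineBranch φ, ?_, ?_, ?_⟩
  · intro i hi
    have hpos := hφ.weight_pos hρ hg hi
    refine ⟨hpos, ⟨_, fun y => rfl⟩, ?_, fun x hx => hφ.affineBranch_apply hρ hg hpos hx⟩
    intro y hy
    obtain ⟨x, hx, rfl⟩ := WeightedSystem.image_subset i hy
    rw [hφ.affineBranch_apply hρ hg hpos hx]
    exact hrange _
  · have h := hφ.model_rhoOne hρ hg
    exact ⟨h, by rw [BranchSystem.pressure, BranchSystem.pressure, h]⟩
  · intro F hF hFf h0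
    obtain ⟨Ft, hFt, hcomp⟩ := hφ.exists_factor hcont hρ hg hF hFf h0
    refine ⟨Ft, hFt, ?_, ?_, hcomp⟩
    · intro y hy
      rw [← hφ.image_Icc hρ hg] at hy
      obtain ⟨x, hx, rfl⟩ := hy
      rw [hcomp x hx]
      exact hrange _
    · intro i hi y hy
      obtain ⟨x, hx, rfl⟩ := WeightedSystem.image_subset i hy
      rw [hcomp x (Ioo_subset_Icc_self (W.I_subset_Ioo i hx)), hFf i hx,
        hφ.affineBranch_apply hρ hg (hφ.weight_pos hρ hg hi) hx]
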